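/- **Campaign.** A finite set $\mathcal O$ of objectives is partitioned into finitely many axes; each axis is a non-empty sequence $x=(o_1,\dots,o_n)$. Each player $i\in\{1,2\}$ (opponent $-i$) has commanders $c\in\mathcal C^i$. Commander $c$ is responsible for a non-empty set $\mathcal X_c$ of axes, each axis has exactly one responsible commander of each player, and for every commander $c^1$ of Player 1 there is a commander $c^2$ of Player 2 with $\mathcal X_{c^1}=\mathcal X_{c^2}$. A state is $s\in\{1,2\}^{\mathcal O}$ with the component-wise order $\preceq$; $s_o$ is the player who controls $o$. **Actions.** Player 1 (resp. 2) has an open line of control to $o_k$ on $x=(o_1,\dots,o_n)$ at $s$ if $s_{o_j}=1$ for all $j<k$ (resp. $s_{o_j}=2$ for all $j>k$). A feasible action of Player $i$ at $s$ assigns to each objective an order in $\{\mathit{atk},\mathit{rfc},\mathit{none}\}$ such that $\mathit{atk}$ (resp. $\mathit{rfc}$) is used only at objectives with an open line of control for Player $i$ that are controlled by $-i$ (resp. by $i$), and such that each commander of Player $i$ issues at most one order other than $\mathit{none}$ among the objectives on their axes. **Transitions.** There are base attack success probabilities $\alpha^i_{o,s}\in[0,1]$ and reinforce success probabilities $\rho^i_{o,s}\in[0,1]$,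 with the conventions $\alpha^i_{o,s}=1$ if $s_o=i$ and $\rho^i_{o,s}=0$ if $s_o=-i$. Given $s$ and the actions $a^1,a^2$, the next control of each objective is determined independently: if $s_o=i$, the objective passes to $-i$ with probability $\alpha^{-i}_{o,s}\mathbb 1_{\{a^{-i}_o=\mathit{atk}\}}\bigl(1-\rho^i_{o,s}\mathbb 1_{\{a^i_o=\mathit{rfc}\}}\bigr)$, and otherwise stays with $i$. Two assumptions hold: 1. $s\preceq s'$ implies $\alpha^1_{o,s}\ge\alpha^1_{o,s'}$, $\rho^1_{o,s}\ge\rho^1_{o,s'}$, $\alpha^2_{o,s}\le\alpha^2_{o,s'}$ and $\rho^2_{o,s}\le\rho^2_{o,s'}$ for every $o$; 2. if $s_o=i$, $s'_o=-i$ and $s,s'$ agree on all other objectives, then $1-\alpha^{-i}_{o,s}(1-\rho^i_{o,s})\ge\alpha^i_{o,s'}(1-\rho^{-i}_{o,s'})$. **Game.** Given losses $\ell_o\ge 0$ and $\gamma\in(0,1)$, a stationary policy $\pi^i$ selects a probability distribution on the feasible actions of Player $i$ at every state; the two players draw their actions independently. The value is $V(s,\pi^1,\pi^2)=\mathbb E\bigl[\sum_{t\ge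 0}\gamma^t\sum_{o}\ell_o\mathbb 1_{\{s^{(t)}_o=2\}}\bigr]$ for the induced Markov chain with $s^{(0)}=s$. A profile $(\pi^{1*},\pi^{2*})$ is a Markov perfect equilibrium (MPE) if $V(s,\pi^{1*},\pi^2)\le V(s,\pi^{1*},\pi^{2*})\le V(s,\pi^1,\pi^{2*})$ for all $s,\pi^1,\pi^2$. **Axis types and fronts.** At a state $s$ an axis $(o_1,\dots,o_n)$ is of type - *c1* if Player 1 controls all of it; the front of both players is $\{o_n\}$; - *c2* if Player 2 controls all of it; the front of both players is $\{o_1\}$; - *pf* if for some $1\le k<n$ Player 1 controls exactly $o_1,\dots,o_k$; the front of both players is $\{o_k,o_{k+1}\}$; - *sf* if for some $1\le k<n$ Player 1 controls exactly $o_1,\dots,o_{k-1},o_{k+1}$; the front of Player 1 is $\{o_k\}$ and that of Player 2 is $\{o_{k+1}\}$. A state satisfies the initial-state assumption if every axis is of one of these four types. The *achievable* states of a policy profile are the states visited with positive probability at some stage $t\ge 0$ from some initial state that satisfies the initial-state assumption. **Proposition.** 1. For every policy profile, the set of achievable states is exactly the set of states at which every axis is of type *c1*, *c2*, *pf* or *sf*.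 In particular, from any initial state that satisfies the initial-state assumption, the game stays in this set almost surely, under every policy profile. 2. There is an MPE such that at every achievable state, every action that a player $i$ selects with positive probability has the following property: ($\star$) each commander of Player $i$ issues exactly one order other than $\mathit{none}$, and every such order is an $\mathit{atk}$ at an objective of the front of Player $i$ controlled by $-i$ or a $\mathit{rfc}$ at an objective of the front of Player $i$ controlled by $i$. 3. Suppose that $\ell_o>0$ for every $o$, and that for all $i$, $s$ and all $o$ to which Player $i$ has an open line of control at $s$, $\alpha^i_{o,s}>0$ if $s_o=-i$ and $0<\rho^i_{o,s}<1$ if $s_o=i$. Then in every MPE, at every achievable state, every action selected with positive probability has property ($\star$). -/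

import Mathlib

namespace CampaignGame

/-- The two players: `0` stands for Player 1 and `1` for Player 2. -/
abbrev Player := Fin 2

/-- The opponent of a player. -/
def opp (i : Player) : Player := Fin.rev i

/-- The three possible orders for an objective: attack, reinforce, none. -/
inductive MilOrder
  | atk
  | rfc
  | none
  deriving DecidableEq

instance : Fintype MilOrder := ⟨{.atk, .rfc, .none}, fun x => by cases x <;> simp⟩

/-- Axes and command structure of a campaign. `X` is the set of axes and `C i` is the set of
commanders of player `i`. Axis `x` consists of `len x` objectives, numbered from `0`
(next to the bases of Player 1) to `len x - 1` (next to the bases of Player 2). -/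
structure Layout (X : Type*) (C : Player → Type*) where
  /-- the number of objectives of an axis -/
  len : X → ℕ
  len_pos : ∀ x, 0 < len x
  /-- the axes under the responsibility of a commander -/
  resp : ∀ i : Player, C i → Set X
  resp_nonempty : ∀ i c, (resp i c).Nonempty
  existsUnique_resp : ∀ i x, ∃! c : C i, x ∈ resp i c
  symmetric : ∀ c₁ : C 0, ∃ c₂ : C 1, resp 0 c₁ = resp 1 c₂

namespace Layout

variable {X : Type*} {C : Player → Type*} (G : Layout X C)

/-- Objectives: the axes partition them, and `⟨x, k⟩` is the `k`-th one (from `0`) of axis `x`. -/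
abbrev Objective := Σ x : X, Fin (G.len x)

/-- A campaign state says which player controls each objective. The order on states is
component-wise, with Player 1 below Player 2. -/
abbrev State := G.Objective → Player

/-- An assignment of orders to all objectives. -/
abbrev Action := G.Objective → MilOrder

/-- Player `i` has an open line of control to objective `o` at state `s`. -/
def OpenLoC (i : Player) (s : G.State) (o : G.Objective) : Prop :=
  ∀ j : Fin (G.len o.1), (if i = 0 then j < o.2 else o.2 < j) → s ⟨o.1, j⟩ = i

/-- The number of attack or reinforce orders on objectives of commander `c`. -/
noncomputable def numOrders (i : Player) (c : C i) (a : G.Action) : ℕ :=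
  {o : G.Objective | o.1 ∈ G.resp i c ∧ (a o = .atk ∨ a o = .rfc)}.ncard

/-- Feasibility of an action of player `i` at state `s`. -/
def Feasible (i : Player) (s : G.State) (a : G.Action) : Prop :=
  (∀ o, (¬ G.OpenLoC i s o → a o = .none) ∧
    (G.OpenLoC i s o → s o = i → a o = .none ∨ a o = .rfc) ∧
    (G.OpenLoC i s o → s o = opp i → a o = .none ∨ a o = .atk)) ∧
  ∀ c : C i, G.numOrders i c a ≤ 1

/-- The set of feasible actions of player `i` at state `s`. -/
def FeasAct (i : Player) (s : G.State) : Type _ := {a : G.Action // G.Feasible i s a}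

/-- Type c1: Player 1 controls the whole axis. -/
def IsC1 (s : G.State) (x : X) : Prop := ∀ j, s ⟨x, j⟩ = 0

/-- Type c2: Player 2 controls the whole axis. -/
def IsC2 (s : G.State) (x : X) : Prop := ∀ j, s ⟨x, j⟩ = 1

/-- Type pf (pure front), with the front at the positions `k` and `k + 1`. -/
def IsPFAt (s : G.State) (x : X) (k : ℕ) : Prop :=
  k + 1 < G.len x ∧ ∀ j : Fin (G.len x),
    ((j : ℕ) ≤ k → s ⟨x, j⟩ = 0) ∧ (k + 1 ≤ (j : ℕ) → s ⟨x, j⟩ = 1)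

/-- Type sf (split front), with the front of Player 1 at `k` and that of Player 2 at `k + 1`. -/
def IsSFAt (s : G.State) (x : X) (k : ℕ) : Prop :=
  k + 1 < G.len x ∧ ∀ j : Fin (G.len x),
    ((j : ℕ) < k → s ⟨x, j⟩ = 0) ∧ ((j : ℕ) = k → s ⟨x, j⟩ = 1) ∧
    ((j : ℕ) = k + 1 → s ⟨x, j⟩ = 0) ∧ (k + 2 ≤ (j : ℕ) → s ⟨x, j⟩ = 1)

/-- The axis `x` is of type c1, c2, pf or sf at state `s`. -/
def AxisTyped (s : G.State) (x : X) : Prop :=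
  G.IsC1 s x ∨ G.IsC2 s x ∨ (∃ k, G.IsPFAt s x k) ∨ (∃ k, G.IsSFAt s x k)

/-- The states at which every axis is of type c1, c2, pf or sf. -/
def typedStates : Set G.State := {s | ∀ x, G.AxisTyped s x}

/-- The battle front of player `i` on axis `x` at state `s`. -/
def front (i : Player) (x : X) (s : G.State) : Set G.Objective :=
  {o | o.1 = x ∧
    ((G.IsC1 s x ∧ (o.2 : ℕ) + 1 = G.len x) ∨
     (G.IsC2 s x ∧ (o.2 : ℕ) = 0) ∨
     (∃ k, G.IsPFAt s x k ∧ ((o.2 : ℕ) = k ∨ (o.2 : ℕ) = k + 1)) ∨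
     (∃ k, G.IsSFAt s x k ∧ (o.2 : ℕ) = if i = 0 then k else k + 1))}

/-- Every commander of player `i` issues exactly one order, and all orders attack or reinforce
at the battle front of player `i` on the axis concerned. -/
def IsFrontAction (i : Player) (s : G.State) (a : G.Action) : Prop :=
  (∀ x : X, ∀ o : G.Objective, o.1 = x →
    (o ∈ G.front i x s → s o = opp i → a o = .none ∨ a o = .atk) ∧
    (o ∈ G.front i x s → s o = i → a o = .none ∨ a o = .rfc) ∧
    (o ∉ G.front i x s → a o = .none)) ∧
  ∀ c : C i, G.numOrders i c a = 1

end Layout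

/-- A campaign: axes and command structure, together with the base attack success probabilities
`α`, the reinforce success probabilities `ρ`, the losses and the discount factor. The fields
`α_own` and `ρ_opp` are notational conventions on values with no operational meaning. -/
structure Campaign (X : Type*) (C : Player → Type*) extends Layout X C where
  /-- base attack success probabilities -/
  α : Player → toLayout.Objective → toLayout.State → ℝ
  /-- reinforce success probabilities -/
  ρ : Player → toLayout.Objective → toLayout.State → ℝ
  /-- loss of Player 1 per stage for an objective controlled by Player 2 -/
  loss : toLayout.Objective → ℝ
  /-- discount factor -/
  γ : ℝ
  α_mem : ∀ i o s, α i o s ∈ Set.Icc (0 : ℝ) 1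
  ρ_mem : ∀ i o s, ρ i o s ∈ Set.Icc (0 : ℝ) 1
  α_own : ∀ i o s, s o = i → α i o s = 1
  ρ_opp : ∀ i o s, s o = opp i → ρ i o s = 0
  loss_nonneg : ∀ o, 0 ≤ loss o
  γ_mem : γ ∈ Set.Ioo (0 : ℝ) 1

namespace Campaign

variable {X : Type*} [Fintype X] [DecidableEq X] {C : Player → Type*} (G : Campaign X C)

noncomputable instance (i : Player) (s : G.State) : Fintype (G.FeasAct i s) :=
  haveI : Finite (G.FeasAct i s) := inferInstanceAs (Finite {a : G.Action // G.Feasible i s a})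
  Fintype.ofFinite _

/-- Success probabilities of Player 1 are antitone and those of Player 2 isotone in the state. -/
def MonotoneOdds : Prop :=
  ∀ s s' : G.State, s ≤ s' → ∀ o : G.Objective,
    G.α 0 o s' ≤ G.α 0 o s ∧ G.ρ 0 o s' ≤ G.ρ 0 o s ∧
    G.α 1 o s ≤ G.α 1 o s' ∧ G.ρ 1 o s ≤ G.ρ 1 o s'

/-- The probability of gaining control of a reinforced objective is at most the probability of
maintaining control of that objective when reinforced, all other control being identical. -/
def DefenseFavored : Prop :=
  ∀ (i : Player) (o : G.Objective) (s s' : G.State), s o = i → s' o = opp i →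
    (∀ o', o' ≠ o → s o' = s' o') →
    G.α i o s' * (1 - G.ρ (opp i) o s') ≤ 1 - G.α (opp i) o s * (1 - G.ρ i o s)

/-- Positive losses, positive base attack success probabilities, and reinforce success
probabilities strictly between `0` and `1`, wherever the respective order is possible. -/
def Nondegenerate : Prop :=
  (∀ o, 0 < G.loss o) ∧
  (∀ i s o, G.OpenLoC i s o → s o = opp i → 0 < G.α i o s) ∧
  (∀ i s o, G.OpenLoC i s o → s o = i → 0 < G.ρ i o s ∧ G.ρ i o s < 1)

/-- Probability that objective `o` is controlled by player `i` at the next stage, given the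
current state `s` and the actions `a 0`, `a 1` of the players. -/
def objProb (s : G.State) (a : Player → G.Action) (o : G.Objective) (i : Player) : ℝ :=
  if s o = i then
    1 - G.α (opp i) o s * (if a (opp i) o = .atk then 1 else 0) *
      (1 - G.ρ i o s * (if a i o = .rfc then 1 else 0))
  else
    G.α i o s * (if a i o = .atk then 1 else 0) *
      (1 - G.ρ (opp i) o s * (if a (opp i) o = .rfc then 1 else 0))

/-- Transition probability from `s` to `s'`: simultaneous battles are independent. -/
def transProb (s : G.State) (a : Player → G.Action) (s' : G.State) : ℝ :=
  ∏ o : G.Objective, G.objProb s a o (s' o)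

/-- Stage loss of Player 1. -/
def stageLoss (s : G.State) : ℝ := ∑ o : G.Objective, if s o = 1 then G.loss o else 0

/-- Stationary policies: a probability distribution on the feasible actions at every state. -/
def Policy (i : Player) : Type _ := ∀ s : G.State, stdSimplex ℝ (G.FeasAct i s)

/-- One-step transition probabilities of the Markov chain induced by a policy profile; the
players draw their actions independently. -/
noncomputable def chain (π₁ : G.Policy 0) (π₂ : G.Policy 1) (s s' : G.State) : ℝ :=
  ∑ a₁ : G.FeasAct 0 s, ∑ a₂ : G.FeasAct 1 s,
    (π₁ s).1 a₁ * (π₂ s).1 a₂ * G.transProb s ![a₁.1, a₂.1] s'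

/-- The law of the state at stage `t` of that chain started from `s₀`. -/
noncomputable def stateLaw (π₁ : G.Policy 0) (π₂ : G.Policy 1) (s₀ : G.State) :
    ℕ → G.State → ℝ
  | 0 => fun s => if s = s₀ then 1 else 0
  | t + 1 => fun s' => ∑ s : G.State, stateLaw π₁ π₂ s₀ t s * G.chain π₁ π₂ s s'

/-- Expected discounted cumulative loss: the sum over the stages `t` of `γ ^ t` times the
expected stage loss at stage `t`. -/
noncomputable def value (s₀ : G.State) (π₁ : G.Policy 0) (π₂ : G.Policy 1) : ℝ :=
  ∑' t : ℕ, G.γ ^ t * ∑ s : G.State, G.stateLaw π₁ π₂ s₀ t s * G.stageLoss s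

/-- Markov perfect equilibria: Player 1 minimizes the value and Player 2 maximizes it. -/
def IsMPE (π₁ : G.Policy 0) (π₂ : G.Policy 1) : Prop :=
  ∀ (s : G.State) (π₁' : G.Policy 0) (π₂' : G.Policy 1),
    G.value s π₁ π₂' ≤ G.value s π₁ π₂ ∧ G.value s π₁ π₂ ≤ G.value s π₁' π₂

/-- The states visited with positive probability at some stage, from the initial state `s₀`. -/
def reachableFrom (s₀ : G.State) (π₁ : G.Policy 0) (π₂ : G.Policy 1) : Set G.State :=
  {s | ∃ t : ℕ, 0 < G.stateLaw π₁ π₂ s₀ t s}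

/-- Admissible initial states: every axis is of type c1, c2, pf or sf. -/
def InitialAssumption (s₀ : G.State) : Prop := ∀ x : X, G.AxisTyped s₀ x

/-- The achievable states of a policy profile: those reachable from an initial state that
satisfies the initial-state assumption. -/
def achievable (π₁ : G.Policy 0) (π₂ : G.Policy 1) : Set G.State :=
  {s | ∃ s₀ : G.State, G.InitialAssumption s₀ ∧ s ∈ G.reachableFrom s₀ π₁ π₂}

/-- At every achievable state of the profile, both players randomize over actions in which each
commander issues exactly one order, at a battle front. -/
def PlaysAtFronts (π₁ : G.Policy 0) (π₂ : G.Policy 1) : Prop :=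
  ∀ s ∈ G.achievable π₁ π₂,
    (∀ a : G.FeasAct 0 s, 0 < (π₁ s).1 a → G.IsFrontAction 0 s a.1) ∧
    (∀ a : G.FeasAct 1 s, 0 < (π₂ s).1 a → G.IsFrontAction 1 s a.1)

end Campaign

end CampaignGame

open scoped BigOperators

namespace CampaignGame

/-! ### Finite matrix games and discounted stochastic games -/

/-! The game is a finite discounted zero-sum stochastic game. By Shapley's theorem there are a
function `V` and a profile of optimal strategies in the one-stage games with continuation values
`V`, whose values are `V` again. Such profiles are exactly the equilibria (`IsSaddle.isMPE`,
`IsMPE.isSaddle`), so everything reduces to comparing actions in one-stage games.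

The key fact is that `V` is monotone in the state. For `s ≤ t`, Player 1 at `s` can give orders
wherever he would at `t`, and Player 2 at `t` wherever he would at `s`. The two assumptions on the
odds then make every objective at least as likely to fall to Player 2 from `t` as from `s`
(`objProb_le_objProb`). Transitions are product measures, so this orders expectations of monotone
functions; a contraction argument removes the circularity. Positive losses make `V` strictly
monotone.

Hence an action that improves the odds at every objective is a better action. Axis types persist
because only the two objectives around the front can change hands. At typed states, an attack is
possible only at the front, and an objective that both players can reach lies on both fronts, so a
reinforcement elsewhere is never tested. Moving all idle or useless orders to the front is therefore
weakly better. Applying this map to the optimal strategies of both players keeps them optimal, which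
gives the equilibrium at the fronts.

In the nondegenerate case the move is strictly better. A commander who does not own all his axes can
attack at a front with positive chance of success. If he owns them all, the opposing commander of
the same axes is in the former situation, hence attacks at a front, and reinforcing that objective
pays. -/

theorem exists_matrix_saddle {A B : Type*} [Fintype A] [Fintype B] [Nonempty A] [Nonempty B]
    (M : A → B → ℝ) :
    ∃ (v : ℝ) (x : stdSimplex ℝ A) (y : stdSimplex ℝ B),
      (∀ b, ∑ a, x.1 a * M a b ≤ v) ∧ ∀ a, v ≤ ∑ b, y.1 b * M a b := by
  classical
  let f : (A → ℝ) → (B → ℝ) → ℝ := fun x y => ∑ a, ∑ b, x a * y b * M a b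
  have hcont₁ : ∀ y, Continuous fun x => f x y := fun y => by simp only [f]; fun_prop
  have hcont₂ : ∀ x, Continuous fun y => f x y := fun x => by simp only [f]; fun_prop
  let l₁ : (B → ℝ) → (A → ℝ) →ₗ[ℝ] ℝ := fun y =>
    { toFun := fun x => f x y
      map_add' := fun u v => by
        simp only [f, ← Finset.sum_add_distrib, Pi.add_apply]
        exact Finset.sum_congr rfl fun a _ => Finset.sum_congr rfl fun b _ => by ring
      map_smul' := fun c u => by
        simp only [f, Finset.mul_sum, Pi.smul_apply, smul_eq_mul, RingHom.id_apply]
        exact Finset.sum_congr rfl fun a _ => Finset.sum_congr rfl fun b _ => by ring }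
  let l₂ : (A → ℝ) → (B → ℝ) →ₗ[ℝ] ℝ := fun x =>
    { toFun := fun y => f x y
      map_add' := fun u v => by
        simp only [f, ← Finset.sum_add_distrib, Pi.add_apply]
        exact Finset.sum_congr rfl fun a _ => Finset.sum_congr rfl fun b _ => by ring
      map_smul' := fun c u => by
        simp only [f, Finset.mul_sum, Pi.smul_apply, smul_eq_mul, RingHom.id_apply]
        exact Finset.sum_congr rfl fun a _ => Finset.sum_congr rfl fun b _ => by ring }
  -- Von Neumann's minimax theorem as the bilinear case of Sion's; testing the saddle point against
  -- vertices of the simplices gives the bounds for pure actions.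
  obtain ⟨x, hx, y, hy, hxy⟩ := Sion.exists_isSaddlePointOn (X := stdSimplex ℝ A)
    (Y := stdSimplex ℝ B) (f := f)
    ⟨_, single_mem_stdSimplex ℝ (Classical.arbitrary A)⟩ (convex_stdSimplex ℝ A)
    (isCompact_stdSimplex ℝ A)
    (fun y _ => (hcont₁ y).lowerSemicontinuous.lowerSemicontinuousOn _)
    (fun y _ => ((l₁ y).convexOn (convex_stdSimplex ℝ A)).quasiconvexOn)
    (convex_stdSimplex ℝ B) ⟨_, single_mem_stdSimplex ℝ (Classical.arbitrary B)⟩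
    (isCompact_stdSimplex ℝ B)
    (fun x _ => (hcont₂ x).upperSemicontinuous.upperSemicontinuousOn _)
    (fun x _ => ((l₂ x).concaveOn (convex_stdSimplex ℝ B)).quasiconcaveOn)
  refine ⟨f x y, ⟨x, hx⟩, ⟨y, hy⟩, fun b => ?_, fun a => ?_⟩
  · have := hxy x hx (Pi.single b 1) (single_mem_stdSimplex ℝ b)
    simpa [f, Pi.single_apply] using this
  · have := hxy (Pi.single a 1) (single_mem_stdSimplex ℝ a) y hy
    simpa [f, Pi.single_apply] using this

/-- If moves `a'` of the minimizer and `b` of the maximizer in two matrix games can be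
translated by `φ` and `ψ` so that the payoffs compare, then so do the values. -/
theorem matrix_value_le {A B A' B' : Type*} [Fintype A] [Fintype B] [Fintype A'] [Fintype B']
    {M : A → B → ℝ} {M' : A' → B' → ℝ} {x : stdSimplex ℝ A'} {y : stdSimplex ℝ B}
    {v v' e : ℝ} (φ : A' → A) (ψ : B → B')
    (hv : ∀ a, v ≤ ∑ b, y.1 b * M a b) (hv' : ∀ b, ∑ a, x.1 a * M' a b ≤ v')
    (h : ∀ a' b, M (φ a') b ≤ M' a' (ψ b) + e) : v ≤ v' + e := by
  have hx0 := x.2.1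
  have hy0 := y.2.1
  calc v = ∑ a', x.1 a' * v := by rw [← Finset.sum_mul, x.2.2, one_mul]
    _ ≤ ∑ a', x.1 a' * ∑ b, y.1 b * M (φ a') b :=
        Finset.sum_le_sum fun a' _ => mul_le_mul_of_nonneg_left (hv _) (hx0 a')
    _ ≤ ∑ a', x.1 a' * ∑ b, y.1 b * (M' a' (ψ b) + e) :=
        Finset.sum_le_sum fun a' _ => mul_le_mul_of_nonneg_left
          (Finset.sum_le_sum fun b _ => mul_le_mul_of_nonneg_left (h _ _) (hy0 b)) (hx0 a')
    _ = ∑ a', ∑ b, (x.1 a' * (y.1 b * M' a' (ψ b)) + x.1 a' * (y.1 b * e)) := by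
        refine Finset.sum_congr rfl fun a' _ => ?_
        rw [Finset.mul_sum]
        exact Finset.sum_congr rfl fun b _ => by ring
    _ = (∑ b, y.1 b * ∑ a', x.1 a' * M' a' (ψ b)) + e := by
        simp only [Finset.sum_add_distrib]
        congr 1
        · rw [Finset.sum_comm]
          refine Finset.sum_congr rfl fun b _ => ?_
          rw [Finset.mul_sum]
          exact Finset.sum_congr rfl fun a' _ => by ring
        · simp only [← Finset.mul_sum, ← Finset.sum_mul]
          rw [x.2.2, y.2.2]; ring
    _ ≤ (∑ b, y.1 b * v') + e :=
        by gcongr with b _; exacts [hy0 b, hv' _]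
    _ = v' + e := by rw [← Finset.sum_mul, y.2.2, one_mul]

/-- Payoffs of the one-stage game of a discounted stochastic game with continuation values `V`. -/
def stagePayoff {S : Type*} [Fintype S] {A B : S → Type*} (r : S → ℝ) (g : ℝ)
    (p : ∀ s, A s → B s → S → ℝ) (V : S → ℝ) (s : S) (a : A s) (b : B s) : ℝ :=
  r s + g * ∑ t, p s a b t * V t

/-- The profile `(x, y)` consists of optimal strategies of the one-stage games with continuation
values `V`, whose values are again given by `V`. -/
def IsStationarySaddle {S : Type*} [Fintype S] {A B : S → Type*} [∀ s, Fintype (A s)]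
    [∀ s, Fintype (B s)] (r : S → ℝ) (g : ℝ) (p : ∀ s, A s → B s → S → ℝ) (V : S → ℝ)
    (x : ∀ s, stdSimplex ℝ (A s)) (y : ∀ s, stdSimplex ℝ (B s)) : Prop :=
  ∀ s, (∀ b, ∑ a, (x s).1 a * stagePayoff r g p V s a b ≤ V s) ∧
    ∀ a, V s ≤ ∑ b, (y s).1 b * stagePayoff r g p V s a b

/-- Shapley's theorem on finite discounted zero-sum stochastic games. -/
theorem exists_isStationarySaddle {S : Type*} [Fintype S] {A B : S → Type*} [∀ s, Fintype (A s)]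
    [∀ s, Fintype (B s)] [∀ s, Nonempty (A s)] [∀ s, Nonempty (B s)] (r : S → ℝ) {g : ℝ}
    (hg : g ∈ Set.Ioo (0 : ℝ) 1) (p : ∀ s, A s → B s → S → ℝ) (hp0 : ∀ s a b t, 0 ≤ p s a b t)
    (hp1 : ∀ s a b, ∑ t, p s a b t = 1) :
    ∃ V x y, IsStationarySaddle r g p V x y := by
  -- `T` is the Shapley operator, a contraction of ratio `g` in the sup norm; optimal strategies at
  -- its fixed point form the saddle.
  choose T x y hx hy using fun (V : S → ℝ) (s : S) =>
    exists_matrix_saddle (fun a b => stagePayoff r g p V s a b)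
  have key : ∀ V W s, T V s ≤ T W s + g * dist V W := by
    intro V W s
    refine matrix_value_le id id (hy V s) (hx W s) fun a b => ?_
    simp only [stagePayoff, id]
    have : ∑ t, p s a b t * V t ≤ ∑ t, p s a b t * W t + dist V W := by
      calc ∑ t, p s a b t * V t ≤ ∑ t, p s a b t * (W t + dist V W) := by
            refine Finset.sum_le_sum fun t _ => mul_le_mul_of_nonneg_left ?_ (hp0 s a b t)
            have h1 := dist_le_pi_dist V W t
            rw [Real.dist_eq] at h1
            have h2 := le_abs_self (V t - W t)
            linarith
        _ = _ := by
            simp only [mul_add, Finset.sum_add_distrib, ← Finset.sum_mul]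
            rw [hp1, one_mul]
    nlinarith [mul_le_mul_of_nonneg_left this hg.1.le]
  have hT : ContractingWith ⟨g, hg.1.le⟩ T := by
    refine ⟨by exact_mod_cast hg.2, LipschitzWith.of_dist_le_mul fun V W => ?_⟩
    change dist (T V) (T W) ≤ g * dist V W
    refine (dist_pi_le_iff (mul_nonneg hg.1.le dist_nonneg)).2 fun s => ?_
    rw [Real.dist_eq, abs_le]
    have h1 := key V W s
    have h2 := key W V s
    rw [dist_comm] at h2
    constructor <;> linarith
  have hfix : T hT.fixedPoint = hT.fixedPoint := hT.fixedPoint_isFixedPt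
  refine ⟨hT.fixedPoint, x hT.fixedPoint, y hT.fixedPoint, fun s => ⟨fun b => ?_, fun a => ?_⟩⟩
  · exact (hx hT.fixedPoint s b).trans_eq (congrFun hfix s)
  · exact (congrFun hfix s).symm.trans_le (hy hT.fixedPoint s a)

/-- A function that is at least its discounted mean is nonnegative. -/
theorem nonneg_of_discounted_le {S : Type*} [Fintype S] {g : ℝ} (hg : g ∈ Set.Ioo (0 : ℝ) 1)
    {P : S → S → ℝ} (hP0 : ∀ s t, 0 ≤ P s t) (hP1 : ∀ s, ∑ t, P s t = 1) {D : S → ℝ}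
    (hD : ∀ s, g * ∑ t, P s t * D t ≤ D s) (s : S) : 0 ≤ D s := by
  have : Nonempty S := ⟨s⟩
  -- At a minimizer `m`, the mean of `D` is at least `D m`, so `g * D m ≤ D m`.
  obtain ⟨m, hm⟩ := Finite.exists_min D
  have h1 : D m ≤ ∑ t, P m t * D t := by
    calc D m = ∑ t, P m t * D m := by rw [← Finset.sum_mul, hP1, one_mul]
      _ ≤ _ := Finset.sum_le_sum fun t _ => mul_le_mul_of_nonneg_left (hm t) (hP0 m t)
  have h2 := hD m
  have h3 := mul_le_mul_of_nonneg_left h1 hg.1.le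
  have h4 : 0 ≤ D m := by nlinarith [hg.2]
  exact h4.trans (hm s)

/-! ### Products of distributions on `Fin 2` -/

section Product

variable {ι : Type*} [Fintype ι] [DecidableEq ι]

/-- Expectation of `f` under the product of the distributions `p o` on `Fin 2`. -/
def prodExp (p : ι → Fin 2 → ℝ) (f : (ι → Fin 2) → ℝ) : ℝ := ∑ s, (∏ o, p o (s o)) * f s

/-- Each `p o` is a probability distribution. -/
def IsProbFamily {κ : Type*} (p : κ → Fin 2 → ℝ) : Prop :=
  ∀ o, (∀ b, 0 ≤ p o b) ∧ p o 0 + p o 1 = 1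

theorem sum_prod_of_isProbFamily {p : ι → Fin 2 → ℝ} (hp : IsProbFamily p) :
    ∑ s : ι → Fin 2, ∏ o, p o (s o) = 1 := by
  rw [← Fintype.prod_sum]
  exact Finset.prod_eq_one fun o _ => by rw [Fin.sum_univ_two, (hp o).2]

/-- Conditioning on all coordinates except `o` isolates the dependence on `p o`, so that
distributions can be compared one coordinate at a time. -/
theorem prodExp_split (o : ι) (p : ι → Fin 2 → ℝ) (f : (ι → Fin 2) → ℝ) :
    prodExp p f = ∑ u : {j // j ≠ o} → Fin 2, (∏ j : {j // j ≠ o}, p j (u j)) *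
      (p o 0 * f ((Equiv.funSplitAt o (Fin 2)).symm (0, u)) +
        p o 1 * f ((Equiv.funSplitAt o (Fin 2)).symm (1, u))) := by
  have key : ∀ (b : Fin 2) (u : {j // j ≠ o} → Fin 2),
      ∏ j, p j ((Equiv.funSplitAt o (Fin 2)).symm (b, u) j) =
        p o b * ∏ j : {j // j ≠ o}, p j (u j) := by
    intro b u
    rw [Fintype.prod_eq_mul_prod_subtype_ne _ o]
    congr 1
    · simp [Equiv.funSplitAt, Equiv.piSplitAt]
    · refine Finset.prod_congr rfl fun j _ => ?_
      have := j.2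
      simp [Equiv.funSplitAt, Equiv.piSplitAt, this]
  unfold prodExp
  rw [← (Equiv.funSplitAt o (Fin 2)).symm.sum_comp, Fintype.sum_prod_type, Fin.sum_univ_two,
    ← Finset.sum_add_distrib]
  refine Finset.sum_congr rfl fun u _ => ?_
  rw [key, key]
  ring

omit [Fintype ι] in
theorem glue_le_glue (o : ι) (u : {j // j ≠ o} → Fin 2) :
    (Equiv.funSplitAt o (Fin 2)).symm (0, u) ≤ (Equiv.funSplitAt o (Fin 2)).symm (1, u) := by
  intro j
  by_cases h : j = o <;> simp [Equiv.funSplitAt, Equiv.piSplitAt, h]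

omit [Fintype ι] in
theorem glue_lt_glue (o : ι) (u : {j // j ≠ o} → Fin 2) :
    (Equiv.funSplitAt o (Fin 2)).symm (0, u) < (Equiv.funSplitAt o (Fin 2)).symm (1, u) := by
  refine lt_of_le_of_ne (glue_le_glue o u) fun h => ?_
  have := congrFun h o
  simp [Equiv.funSplitAt, Equiv.piSplitAt] at this

theorem prodExp_le_of_eq_off {p p' : ι → Fin 2 → ℝ} (hp : IsProbFamily p)
    (hp' : IsProbFamily p') (o : ι) (hoff : ∀ j, j ≠ o → p j = p' j) (h : p o 1 ≤ p' o 1)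
    {f : (ι → Fin 2) → ℝ} (hf : Monotone f) : prodExp p f ≤ prodExp p' f := by
  rw [prodExp_split o, prodExp_split o]
  refine Finset.sum_le_sum fun u _ => ?_
  rw [Finset.prod_congr rfl fun j _ => congrFun (hoff j.1 j.2) (u j)]
  refine mul_le_mul_of_nonneg_left ?_ (Finset.prod_nonneg fun j _ => (hp' _).1 _)
  have h0 : p o 0 = 1 - p o 1 := by linarith [(hp o).2]
  have h0' : p' o 0 = 1 - p' o 1 := by linarith [(hp' o).2]
  rw [h0, h0']
  nlinarith [mul_nonneg (sub_nonneg.2 h) (sub_nonneg.2 (hf (glue_le_glue o u)))]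

theorem prodExp_lt_of_eq_off {p p' : ι → Fin 2 → ℝ} (hp : IsProbFamily p)
    (hp' : IsProbFamily p') (o : ι) (hoff : ∀ j, j ≠ o → p j = p' j) (h : p o 1 < p' o 1)
    {f : (ι → Fin 2) → ℝ} (hf : StrictMono f) : prodExp p f < prodExp p' f := by
  have h0 : p o 0 = 1 - p o 1 := by linarith [(hp o).2]
  have h0' : p' o 0 = 1 - p' o 1 := by linarith [(hp' o).2]
  have hpos : ∀ u, 0 < (p' o 1 - p o 1) * (f ((Equiv.funSplitAt o (Fin 2)).symm (1, u)) -
      f ((Equiv.funSplitAt o (Fin 2)).symm (0, u))) :=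
    fun u => mul_pos (sub_pos.2 h) (sub_pos.2 (hf (glue_lt_glue o u)))
  have hw0 : ∀ u : {j // j ≠ o} → Fin 2, 0 ≤ ∏ j : {j // j ≠ o}, p' j (u j) :=
    fun u => Finset.prod_nonneg fun j _ => (hp' _).1 _
  have hw1 : ∑ u : {j // j ≠ o} → Fin 2, ∏ j : {j // j ≠ o}, p' j (u j) = 1 :=
    sum_prod_of_isProbFamily (p := fun j : {j // j ≠ o} => p' j) fun j => hp' j
  -- Strictness needs one configuration of the other coordinates with positive weight; the weights
  -- sum to 1.
  obtain ⟨u₀, -, hu₀⟩ : ∃ u ∈ (Finset.univ : Finset ({j // j ≠ o} → Fin 2)),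
      0 < ∏ j : {j // j ≠ o}, p' j (u j) := by
    refine Finset.exists_lt_of_sum_lt (f := fun _ => (0 : ℝ)) ?_
    rw [hw1]; simp
  rw [prodExp_split o, prodExp_split o]
  have hterm : ∀ u : {j // j ≠ o} → Fin 2, (∏ j : {j // j ≠ o}, p j (u j)) =
      ∏ j : {j // j ≠ o}, p' j (u j) :=
    fun u => Finset.prod_congr rfl fun j _ => congrFun (hoff j.1 j.2) (u j)
  simp only [hterm]
  rw [h0, h0']
  refine Finset.sum_lt_sum (fun u _ => ?_) ⟨u₀, Finset.mem_univ _, ?_⟩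
  · exact mul_le_mul_of_nonneg_left (by nlinarith [hpos u]) (hw0 u)
  · exact mul_lt_mul_of_pos_left (by nlinarith [hpos u₀]) hu₀

theorem prodExp_mono {p p' : ι → Fin 2 → ℝ} (hp : IsProbFamily p) (hp' : IsProbFamily p')
    (h : ∀ o, p o 1 ≤ p' o 1) {f : (ι → Fin 2) → ℝ} (hf : Monotone f) :
    prodExp p f ≤ prodExp p' f := by
  -- Hybrid families: the coordinates in `T` have already been switched from `p` to `p'`.
  let q : Finset ι → ι → Fin 2 → ℝ := fun T o => if o ∈ T then p' o else p o
  have hq : ∀ T, IsProbFamily (q T) := by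
    intro T o
    by_cases ho : o ∈ T
    · simpa [q, ho] using hp' o
    · simpa [q, ho] using hp o
  have key : ∀ T, prodExp p f ≤ prodExp (q T) f := by
    intro T
    induction T using Finset.induction_on with
    | empty => simp [q]
    | insert o T ho ih =>
      refine ih.trans (prodExp_le_of_eq_off (hq _) (hq _) o (fun j hj => ?_) ?_ hf)
      · simp [q, hj]
      · simpa [q, ho] using h o
  simpa [q] using key Finset.univ

theorem prodExp_strict_mono {p p' : ι → Fin 2 → ℝ} (hp : IsProbFamily p) (hp' : IsProbFamily p')
    (h : ∀ o, p o 1 ≤ p' o 1) (o : ι) (ho : p o 1 < p' o 1) {f : (ι → Fin 2) → ℝ}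
    (hf : StrictMono f) : prodExp p f < prodExp p' f := by
  have hq : IsProbFamily (Function.update p o (p' o)) := by
    intro j
    by_cases hj : j = o
    · subst hj; simpa using hp' j
    · simpa [hj] using hp j
  refine (prodExp_lt_of_eq_off hp hq o (fun j hj => by simp [hj]) (by simpa using ho) hf).trans_le
    (prodExp_mono hq hp' (fun j => ?_) hf.monotone)
  by_cases hj : j = o
  · subst hj; simp
  · simpa [hj] using h j

end Product

end CampaignGame

namespace CampaignGame

namespace Layout

variable {X : Type*} {C : Player → Type*} (G : Layout X C)

theorem feasible_none (i : Player) (s : G.State) : G.Feasible i s fun _ => .none := by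
  refine ⟨fun o => ⟨fun _ => rfl, fun _ _ => Or.inl rfl, fun _ _ => Or.inl rfl⟩, fun c => ?_⟩
  simp [numOrders]

instance (i : Player) (s : G.State) : Nonempty (G.FeasAct i s) :=
  ⟨⟨_, G.feasible_none i s⟩⟩

end Layout

theorem opp_zero : opp 0 = 1 := rfl

theorem opp_one : opp 1 = 0 := rfl

theorem player_cases (i : Player) : i = 0 ∨ i = 1 := by
  fin_cases i <;> simp

namespace Campaign

variable {X : Type*} [Fintype X] [DecidableEq X] {C : Player → Type*} (G : Campaign X C)

/-! ### Transition probabilities -/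

omit [Fintype X] [DecidableEq X] in
theorem objProb_nonneg (s : G.State) (a : Player → G.Action) (o : G.Objective) (i : Player) :
    0 ≤ G.objProb s a o i := by
  have hα := G.α_mem
  have hρ := G.ρ_mem
  unfold objProb
  have h1 := hα i o s
  have h2 := hρ (opp i) o s
  have h3 := hα (opp i) o s
  have h4 := hρ i o s
  split_ifs <;> norm_num <;> first
    | exact h1.1
    | exact h3.2
    | exact mul_nonneg h1.1 (by linarith [h2.2])
    | nlinarith [h3.1, h3.2, h4.1, h4.2, mul_nonneg h3.1 h4.1]

omit [Fintype X] [DecidableEq X] in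
theorem objProb_add (s : G.State) (a : Player → G.Action) (o : G.Objective) :
    G.objProb s a o 0 + G.objProb s a o 1 = 1 := by
  unfold objProb
  rcases player_cases (s o) with h | h
  · rw [if_pos h, if_neg (show ¬ s o = 1 by rw [h]; exact zero_ne_one), opp_zero, opp_one]
    ring
  · rw [if_neg (show ¬ s o = 0 by rw [h]; exact one_ne_zero), if_pos h, opp_one, opp_zero]
    ring

omit [Fintype X] [DecidableEq X] in
theorem isProbFamily_objProb (s : G.State) (a : Player → G.Action) :
    IsProbFamily (G.objProb s a) :=
  fun o => ⟨fun i => G.objProb_nonneg s a o i, G.objProb_add s a o⟩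

omit [DecidableEq X] in
theorem transProb_nonneg (s : G.State) (a : Player → G.Action) (t : G.State) :
    0 ≤ G.transProb s a t := Finset.prod_nonneg fun _ _ => G.objProb_nonneg _ _ _ _

theorem sum_transProb (s : G.State) (a : Player → G.Action) : ∑ t, G.transProb s a t = 1 :=
  sum_prod_of_isProbFamily (G.isProbFamily_objProb s a)

/-- Payoff of the one-stage game at `s` with continuation values `V`. -/
abbrev payoff (V : G.State → ℝ) (s : G.State) (a : G.FeasAct 0 s) (b : G.FeasAct 1 s) : ℝ :=
  stagePayoff (A := G.FeasAct 0) (B := G.FeasAct 1) G.stageLoss G.γ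
    (fun s a b => G.transProb s ![a.1, b.1]) V s a b

/-- `V` with the profile `(x, y)` solves the Shapley equation of the campaign. -/
abbrev IsSaddle (V : G.State → ℝ) (x : G.Policy 0) (y : G.Policy 1) : Prop :=
  IsStationarySaddle (A := G.FeasAct 0) (B := G.FeasAct 1) G.stageLoss G.γ
    (fun s a b => G.transProb s ![a.1, b.1]) V x y

theorem exists_isSaddle : ∃ V x y, G.IsSaddle V x y :=
  exists_isStationarySaddle _ G.γ_mem _ (fun _ _ _ _ => G.transProb_nonneg _ _ _)
    fun _ _ _ => G.sum_transProb _ _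

theorem payoff_eq (V : G.State → ℝ) (s : G.State) (a : G.FeasAct 0 s) (b : G.FeasAct 1 s) :
    G.payoff V s a b = G.stageLoss s + G.γ * prodExp (G.objProb s ![a.1, b.1]) V := rfl

/-! ### The Markov chain of a policy profile -/

section Chain

variable (π₁ : G.Policy 0) (π₂ : G.Policy 1)

omit [DecidableEq X] in
theorem chain_nonneg (s t : G.State) : 0 ≤ G.chain π₁ π₂ s t :=
  Finset.sum_nonneg fun a _ => Finset.sum_nonneg fun b _ =>
    mul_nonneg (mul_nonneg ((π₁ s).2.1 a) ((π₂ s).2.1 b)) (G.transProb_nonneg _ _ _)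

theorem sum_chain_mul (W : G.State → ℝ) (s : G.State) :
    ∑ t, G.chain π₁ π₂ s t * W t =
      ∑ a, (π₁ s).1 a * ∑ b, (π₂ s).1 b * ∑ t, G.transProb s ![a.1, b.1] t * W t := by
  simp only [chain, Finset.sum_mul, Finset.mul_sum]
  rw [Finset.sum_comm]
  refine Finset.sum_congr rfl fun a _ => ?_
  rw [Finset.sum_comm]
  exact Finset.sum_congr rfl fun b _ => Finset.sum_congr rfl fun t _ => by ring

theorem sum_chain (s : G.State) : ∑ t, G.chain π₁ π₂ s t = 1 := by
  have := G.sum_chain_mul π₁ π₂ (fun _ => 1) s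
  simp only [mul_one, sum_transProb] at this
  rw [this, (π₂ s).2.2]
  simpa using (π₁ s).2.2

theorem sum_payoff (W : G.State → ℝ) (s : G.State) :
    ∑ a, (π₁ s).1 a * ∑ b, (π₂ s).1 b * G.payoff W s a b =
      G.stageLoss s + G.γ * ∑ t, G.chain π₁ π₂ s t * W t := by
  have h1 := (π₁ s).2.2
  have h2 := (π₂ s).2.2
  rw [sum_chain_mul]
  simp only [payoff, stagePayoff, mul_add, Finset.sum_add_distrib, ← Finset.sum_mul, h2, h1,
    one_mul]
  congr 1
  rw [Finset.mul_sum]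
  refine Finset.sum_congr rfl fun a _ => ?_
  rw [mul_left_comm]
  congr 1
  rw [Finset.mul_sum]
  exact Finset.sum_congr rfl fun b _ => by ring

theorem sum_payoff_comm (W : G.State → ℝ) (s : G.State) :
    ∑ b, (π₂ s).1 b * ∑ a, (π₁ s).1 a * G.payoff W s a b =
      G.stageLoss s + G.γ * ∑ t, G.chain π₁ π₂ s t * W t := by
  rw [← sum_payoff]
  simp only [Finset.mul_sum]
  rw [Finset.sum_comm]
  exact Finset.sum_congr rfl fun a _ => Finset.sum_congr rfl fun b _ => by ring

theorem stateLaw_nonneg (s₀ : G.State) (n : ℕ) (s : G.State) :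
    0 ≤ G.stateLaw π₁ π₂ s₀ n s := by
  induction n generalizing s with
  | zero => simp only [stateLaw]; split_ifs <;> norm_num
  | succ n ih =>
    exact Finset.sum_nonneg fun t _ => mul_nonneg (ih t) (G.chain_nonneg _ _ _ _)

theorem sum_stateLaw (s₀ : G.State) (n : ℕ) : ∑ s, G.stateLaw π₁ π₂ s₀ n s = 1 := by
  induction n with
  | zero => simp [stateLaw]
  | succ n ih =>
    simp only [stateLaw]
    rw [Finset.sum_comm]
    simp only [← Finset.mul_sum, sum_chain, mul_one, ih]

/-- The definition splits off the last transition; splitting off the first one is what the Bellman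
equation needs. -/
theorem stateLaw_succ' (s₀ : G.State) (n : ℕ) (s : G.State) :
    G.stateLaw π₁ π₂ s₀ (n + 1) s = ∑ t, G.chain π₁ π₂ s₀ t * G.stateLaw π₁ π₂ t n s := by
  induction n generalizing s with
  | zero => simp [stateLaw]
  | succ n ih =>
    rw [stateLaw]
    simp only [ih, Finset.sum_mul]
    rw [Finset.sum_comm]
    refine Finset.sum_congr rfl fun t _ => ?_
    rw [stateLaw, Finset.mul_sum]
    exact Finset.sum_congr rfl fun u _ => by ring

theorem summable_value (s₀ : G.State) :
    Summable fun n : ℕ => G.γ ^ n * ∑ s, G.stateLaw π₁ π₂ s₀ n s * G.stageLoss s := by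
  have : Nonempty G.State := ⟨s₀⟩
  obtain ⟨m, hm⟩ := Finite.exists_max fun s => |G.stageLoss s|
  refine Summable.of_norm_bounded (g := fun n => G.γ ^ n * |G.stageLoss m|)
    ((summable_geometric_of_lt_one G.γ_mem.1.le G.γ_mem.2).mul_right _) fun n => ?_
  rw [norm_mul, Real.norm_of_nonneg (pow_nonneg G.γ_mem.1.le n)]
  refine mul_le_mul_of_nonneg_left ?_ (pow_nonneg G.γ_mem.1.le n)
  calc ‖∑ s, G.stateLaw π₁ π₂ s₀ n s * G.stageLoss s‖
      ≤ ∑ s, ‖G.stateLaw π₁ π₂ s₀ n s * G.stageLoss s‖ := norm_sum_le _ _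
    _ ≤ ∑ s, G.stateLaw π₁ π₂ s₀ n s * |G.stageLoss m| := by
        refine Finset.sum_le_sum fun s _ => ?_
        rw [norm_mul, Real.norm_of_nonneg (G.stateLaw_nonneg _ _ _ _ _)]
        exact mul_le_mul_of_nonneg_left (hm s) (G.stateLaw_nonneg _ _ _ _ _)
    _ = |G.stageLoss m| := by rw [← Finset.sum_mul, sum_stateLaw, one_mul]

/-- The Bellman equation of a fixed profile, from conditioning on the first transition. -/
theorem value_eq (s : G.State) :
    G.value s π₁ π₂ = G.stageLoss s + G.γ * ∑ t, G.chain π₁ π₂ s t * G.value t π₁ π₂ := by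
  unfold value
  rw [(G.summable_value π₁ π₂ s).tsum_eq_zero_add]
  congr 1
  · simp [stateLaw]
  · have h : ∀ n : ℕ, G.γ ^ (n + 1) * ∑ u, G.stateLaw π₁ π₂ s (n + 1) u * G.stageLoss u =
        G.γ * ∑ t, G.chain π₁ π₂ s t *
          (G.γ ^ n * ∑ u, G.stateLaw π₁ π₂ t n u * G.stageLoss u) := by
      intro n
      simp only [stateLaw_succ', Finset.sum_mul]
      rw [Finset.sum_comm, Finset.mul_sum, Finset.mul_sum]
      refine Finset.sum_congr rfl fun t _ => ?_
      have : ∀ u, G.chain π₁ π₂ s t * G.stateLaw π₁ π₂ t n u * G.stageLoss u =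
        G.chain π₁ π₂ s t * (G.stateLaw π₁ π₂ t n u * G.stageLoss u) := fun u => by ring
      simp only [this, ← Finset.mul_sum]
      ring
    simp only [h]
    rw [tsum_mul_left, Summable.tsum_finsetSum
      fun t _ => (G.summable_value π₁ π₂ t).mul_left _]
    simp only [tsum_mul_left]

/-- Comparison principle: the excess of a supersolution of the Bellman equation over the value
dominates its own discounted mean. -/
theorem value_le {W : G.State → ℝ}
    (hW : ∀ s, G.stageLoss s + G.γ * ∑ t, G.chain π₁ π₂ s t * W t ≤ W s) (s : G.State) :
    G.value s π₁ π₂ ≤ W s := by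
  refine sub_nonneg.1 (nonneg_of_discounted_le (D := fun s => W s - G.value s π₁ π₂) G.γ_mem
    (G.chain_nonneg π₁ π₂) (G.sum_chain π₁ π₂) (fun s => ?_) s)
  have h1 := G.value_eq π₁ π₂ s
  have h2 := hW s
  simp only [mul_sub, Finset.sum_sub_distrib]
  linarith

theorem le_value {W : G.State → ℝ}
    (hW : ∀ s, W s ≤ G.stageLoss s + G.γ * ∑ t, G.chain π₁ π₂ s t * W t) (s : G.State) :
    W s ≤ G.value s π₁ π₂ := by
  refine sub_nonneg.1 (nonneg_of_discounted_le (D := fun s => G.value s π₁ π₂ - W s) G.γ_mem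
    (G.chain_nonneg π₁ π₂) (G.sum_chain π₁ π₂) (fun s => ?_) s)
  have h1 := G.value_eq π₁ π₂ s
  have h2 := hW s
  simp only [mul_sub, Finset.sum_sub_distrib]
  linarith

end Chain

variable {G}

/-! ### Equilibria and the Shapley equation -/

theorem IsSaddle.value_le {V : G.State → ℝ} {x : G.Policy 0} {y : G.Policy 1}
    (h : G.IsSaddle V x y) (π₂ : G.Policy 1) (s : G.State) : G.value s x π₂ ≤ V s := by
  refine G.value_le x π₂ (fun s => ?_) s
  rw [← sum_payoff_comm]
  calc _ ≤ ∑ b, (π₂ s).1 b * V s :=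
        Finset.sum_le_sum fun b _ => mul_le_mul_of_nonneg_left ((h s).1 b) ((π₂ s).2.1 b)
    _ = V s := by rw [← Finset.sum_mul, (π₂ s).2.2, one_mul]

theorem IsSaddle.le_value {V : G.State → ℝ} {x : G.Policy 0} {y : G.Policy 1}
    (h : G.IsSaddle V x y) (π₁ : G.Policy 0) (s : G.State) : V s ≤ G.value s π₁ y := by
  refine G.le_value π₁ y (fun s => ?_) s
  rw [← sum_payoff]
  calc V s = ∑ a, (π₁ s).1 a * V s := by rw [← Finset.sum_mul, (π₁ s).2.2, one_mul]
    _ ≤ _ := Finset.sum_le_sum fun a _ => mul_le_mul_of_nonneg_left ((h s).2 a) ((π₁ s).2.1 a)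

theorem IsSaddle.isMPE {V : G.State → ℝ} {x : G.Policy 0} {y : G.Policy 1}
    (h : G.IsSaddle V x y) : G.IsMPE x y :=
  fun s π₁ π₂ => ⟨(h.value_le π₂ s).trans (h.le_value x s), (h.value_le y s).trans (h.le_value π₁ s)⟩

/-- The one-shot deviation principle. -/
theorem IsMPE.isSaddle {π₁ : G.Policy 0} {π₂ : G.Policy 1} (h : G.IsMPE π₁ π₂) :
    G.IsSaddle (fun s => G.value s π₁ π₂) π₁ π₂ := by
  classical
  intro s
  refine ⟨fun b => ?_, fun a => ?_⟩
  · by_contra! hlt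
    -- `q` deviates to `b` at every visit to `s`. The old value is a subsolution for `q`, hence at
    -- most the value of `q`; the Bellman equation at `s` then makes the gain strict.
    let q : G.Policy 1 := Function.update π₂ s ⟨Pi.single b 1, single_mem_stdSimplex ℝ b⟩
    have hq : (q s).1 = Pi.single b 1 := congrArg _ (Function.update_self ..)
    have hq' : ∀ u, u ≠ s → q u = π₂ u := fun u hu => Function.update_of_ne hu ..
    have hqs : ∀ W, G.stageLoss s + G.γ * ∑ t, G.chain π₁ q s t * W t =
        ∑ a, (π₁ s).1 a * G.payoff W s a b := by
      intro W
      rw [← sum_payoff_comm]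
      simp [hq, Pi.single_apply]
    have hqo : ∀ u, u ≠ s → ∀ t, G.chain π₁ q u t = G.chain π₁ π₂ u t := by
      intro u hu t
      simp only [chain, hq' u hu]
    have hge : ∀ u, G.value u π₁ π₂ ≤ G.value u π₁ q := by
      refine G.le_value π₁ q (W := fun u => G.value u π₁ π₂) fun u => ?_
      by_cases hu : u = s
      · subst hu
        rw [hqs]
        exact hlt.le
      · simp only [hqo u hu]
        exact (G.value_eq π₁ π₂ u).le
    have h1 := (h s π₁ q).1
    have h2 := G.value_eq π₁ q s
    have h3 := hqs fun u => G.value u π₁ π₂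
    have h4 : ∑ t, G.chain π₁ q s t * G.value t π₁ π₂ ≤ ∑ t, G.chain π₁ q s t * G.value t π₁ q :=
      Finset.sum_le_sum fun t _ => mul_le_mul_of_nonneg_left (hge t) (G.chain_nonneg _ _ _ _)
    have h5 := mul_le_mul_of_nonneg_left h4 G.γ_mem.1.le
    linarith
  · by_contra! hlt
    let q : G.Policy 0 := Function.update π₁ s ⟨Pi.single a 1, single_mem_stdSimplex ℝ a⟩
    have hq : (q s).1 = Pi.single a 1 := congrArg _ (Function.update_self ..)
    have hq' : ∀ u, u ≠ s → q u = π₁ u := fun u hu => Function.update_of_ne hu ..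
    have hqs : ∀ W, G.stageLoss s + G.γ * ∑ t, G.chain q π₂ s t * W t =
        ∑ b, (π₂ s).1 b * G.payoff W s a b := by
      intro W
      rw [← sum_payoff]
      simp [hq, Pi.single_apply]
    have hqo : ∀ u, u ≠ s → ∀ t, G.chain q π₂ u t = G.chain π₁ π₂ u t := by
      intro u hu t
      simp only [chain, hq' u hu]
    have hge : ∀ u, G.value u q π₂ ≤ G.value u π₁ π₂ := by
      refine G.value_le q π₂ (W := fun u => G.value u π₁ π₂) fun u => ?_
      by_cases hu : u = s
      · subst hu
        rw [hqs]
        exact hlt.le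
      · simp only [hqo u hu]
        exact (G.value_eq π₁ π₂ u).ge
    have h1 := (h s q π₂).2
    have h2 := G.value_eq q π₂ s
    have h3 := hqs fun u => G.value u π₁ π₂
    have h4 : ∑ t, G.chain q π₂ s t * G.value t q π₂ ≤ ∑ t, G.chain q π₂ s t * G.value t π₁ π₂ :=
      Finset.sum_le_sum fun t _ => mul_le_mul_of_nonneg_left (hge t) (G.chain_nonneg _ _ _ _)
    have h5 := mul_le_mul_of_nonneg_left h4 G.γ_mem.1.le
    linarith

theorem IsSaddle.sum_eq {V : G.State → ℝ} {x : G.Policy 0} {y : G.Policy 1}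
    (h : G.IsSaddle V x y) (s : G.State) :
    ∑ a, (x s).1 a * ∑ b, (y s).1 b * G.payoff V s a b = V s := by
  refine le_antisymm ?_ ?_
  · rw [sum_payoff, ← sum_payoff_comm]
    calc _ ≤ ∑ b, (y s).1 b * V s :=
          Finset.sum_le_sum fun b _ => mul_le_mul_of_nonneg_left ((h s).1 b) ((y s).2.1 b)
      _ = V s := by rw [← Finset.sum_mul, (y s).2.2, one_mul]
  · calc V s = ∑ a, (x s).1 a * V s := by rw [← Finset.sum_mul, (x s).2.2, one_mul]
      _ ≤ _ := Finset.sum_le_sum fun a _ => mul_le_mul_of_nonneg_left ((h s).2 a) ((x s).2.1 a)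

/-- No action that Player 1 selects in equilibrium is dominated, strictly against some action
that Player 2 selects. -/
theorem IsSaddle.not_dominated_zero {V : G.State → ℝ} {x : G.Policy 0} {y : G.Policy 1}
    (h : G.IsSaddle V x y) {s : G.State} {a a' : G.FeasAct 0 s} (ha : 0 < (x s).1 a)
    (hle : ∀ b, G.payoff V s a' b ≤ G.payoff V s a b) (b : G.FeasAct 1 s) (hb : 0 < (y s).1 b) :
    ¬ G.payoff V s a' b < G.payoff V s a b := by
  intro hlt
  -- Already `a'` costs at least `V s` against `y`, so `a` costs more; as `a` has positive weight,
  -- the mean over `x` would exceed `V s`.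
  have h1 : V s < ∑ b, (y s).1 b * G.payoff V s a b :=
    ((h s).2 a').trans_lt <| Finset.sum_lt_sum
      (fun b _ => mul_le_mul_of_nonneg_left (hle b) ((y s).2.1 b))
      ⟨b, Finset.mem_univ _, mul_lt_mul_of_pos_left hlt hb⟩
  have h2 : ∑ a, (x s).1 a * V s < ∑ a, (x s).1 a * ∑ b, (y s).1 b * G.payoff V s a b :=
    Finset.sum_lt_sum (fun a _ => mul_le_mul_of_nonneg_left ((h s).2 a) ((x s).2.1 a))
      ⟨a, Finset.mem_univ _, mul_lt_mul_of_pos_left h1 ha⟩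
  rw [h.sum_eq, ← Finset.sum_mul, (x s).2.2, one_mul] at h2
  exact lt_irrefl _ h2

/-- No action that Player 2 selects in equilibrium is dominated, strictly against some action
that Player 1 selects. -/
theorem IsSaddle.not_dominated_one {V : G.State → ℝ} {x : G.Policy 0} {y : G.Policy 1}
    (h : G.IsSaddle V x y) {s : G.State} {b b' : G.FeasAct 1 s} (hb : 0 < (y s).1 b)
    (hle : ∀ a, G.payoff V s a b ≤ G.payoff V s a b') (a : G.FeasAct 0 s) (ha : 0 < (x s).1 a) :
    ¬ G.payoff V s a b < G.payoff V s a b' := by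
  intro hlt
  have h1 : ∑ a, (x s).1 a * G.payoff V s a b < V s :=
    (Finset.sum_lt_sum
      (fun a _ => mul_le_mul_of_nonneg_left (hle a) ((x s).2.1 a))
      ⟨a, Finset.mem_univ _, mul_lt_mul_of_pos_left hlt ha⟩).trans_le ((h s).1 b')
  have h2 : ∑ b, (y s).1 b * ∑ a, (x s).1 a * G.payoff V s a b < ∑ b, (y s).1 b * V s :=
    Finset.sum_lt_sum (fun b _ => mul_le_mul_of_nonneg_left ((h s).1 b) ((y s).2.1 b))
      ⟨b, Finset.mem_univ _, mul_lt_mul_of_pos_left h1 hb⟩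
  rw [sum_payoff_comm, ← sum_payoff, h.sum_eq, ← Finset.sum_mul, (y s).2.2, one_mul] at h2
  exact lt_irrefl _ h2

end Campaign

end CampaignGame

/-! ### Monotonicity of the equilibrium value in the state -/

namespace CampaignGame

theorem opp_ne (i : Player) : opp i ≠ i := by
  rcases player_cases i with rfl | rfl <;> decide

theorem opp_opp (i : Player) : opp (opp i) = i := by
  rcases player_cases i with rfl | rfl <;> rfl

theorem one_not_le_zero : ¬ (1 : Player) ≤ 0 := by decide

theorem eq_or_eq_opp (i j : Player) : j = i ∨ j = opp i := by
  rcases player_cases i with rfl | rfl <;> rcases player_cases j with rfl | rfl <;>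
    simp [opp_zero, opp_one]

namespace MilOrder

/-- Indicator of an actual order. -/
def ind (m : MilOrder) : ℝ := if m = .none then 0 else 1

@[simp] theorem ind_none : ind .none = 0 := if_pos rfl

@[simp] theorem ind_atk : ind .atk = 1 := rfl

@[simp] theorem ind_rfc : ind .rfc = 1 := rfl

theorem ind_of_ne {m : MilOrder} (h : m ≠ .none) : ind m = 1 := if_neg h

theorem ind_nonneg (m : MilOrder) : 0 ≤ ind m := by cases m <;> simp

theorem ind_le_one (m : MilOrder) : ind m ≤ 1 := by cases m <;> simp

theorem atk_or_rfc_iff {m : MilOrder} : (m = .atk ∨ m = .rfc) ↔ m ≠ .none := by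
  cases m <;> simp

end MilOrder

open MilOrder

namespace Layout

variable {X : Type*} {C : Player → Type*} {G : Layout X C}

theorem Feasible.own {i : Player} {s : G.State} {a : G.Action} (h : G.Feasible i s a)
    {o : G.Objective} (ho : s o = i) : a o = .none ∨ a o = .rfc := by
  by_cases hl : G.OpenLoC i s o
  · exact (h.1 o).2.1 hl ho
  · exact Or.inl ((h.1 o).1 hl)

theorem Feasible.opp {i : Player} {s : G.State} {a : G.Action} (h : G.Feasible i s a)
    {o : G.Objective} (ho : s o = opp i) : a o = .none ∨ a o = .atk := by
  by_cases hl : G.OpenLoC i s o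
  · exact (h.1 o).2.2 hl ho
  · exact Or.inl ((h.1 o).1 hl)

theorem Feasible.openLoC {i : Player} {s : G.State} {a : G.Action} (h : G.Feasible i s a)
    {o : G.Objective} (ho : a o ≠ .none) : G.OpenLoC i s o := by
  by_contra hl
  exact ho ((h.1 o).1 hl)

/-- The action with orders at the same objectives as `a`, attacking or reinforcing according to
the control of the objectives at `s`. -/
def retype (i : Player) (s : G.State) (a : G.Action) : G.Action :=
  fun o => if a o = .none then .none else if s o = i then .rfc else .atk

theorem retype_eq_none {i : Player} {s : G.State} {a : G.Action} {o : G.Objective} :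
    retype i s a o = .none ↔ a o = .none := by
  unfold retype
  split_ifs <;> simp_all

theorem numOrders_congr {i : Player} {c : C i} {a b : G.Action}
    (h : ∀ o, a o = .none ↔ b o = .none) : G.numOrders i c a = G.numOrders i c b := by
  unfold numOrders
  congr 1
  ext o
  simp only [atk_or_rfc_iff, Set.mem_ofPred_eq, ne_eq, h o]

theorem Feasible.retype {i : Player} {s t : G.State} {a : G.Action} (h : G.Feasible i s a)
    (hl : ∀ o, G.OpenLoC i s o → G.OpenLoC i t o) : G.Feasible i t (retype i t a) := by
  refine ⟨fun o => ⟨fun ho => ?_, fun _ ho => ?_, fun _ ho => ?_⟩, fun c => ?_⟩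
  · exact retype_eq_none.2 ((h.1 o).1 fun h' => ho (hl o h'))
  · unfold Layout.retype
    split_ifs <;> simp
  · unfold Layout.retype
    rw [if_neg (show ¬ t o = i by rw [ho]; exact opp_ne i)]
    split_ifs <;> simp
  · rw [numOrders_congr fun o => retype_eq_none]
    exact h.2 c

theorem OpenLoC.anti {s t : G.State} (h : s ≤ t) {o : G.Objective} (ho : G.OpenLoC 0 t o) :
    G.OpenLoC 0 s o := by
  intro j hj
  have h1 := ho j hj
  have h2 := h ⟨o.1, j⟩
  rw [h1] at h2
  exact le_antisymm h2 (Fin.zero_le _)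

theorem OpenLoC.mono {s t : G.State} (h : s ≤ t) {o : G.Objective} (ho : G.OpenLoC 1 s o) :
    G.OpenLoC 1 t o := by
  intro j hj
  have h1 := ho j hj
  have h2 := h ⟨o.1, j⟩
  rw [h1] at h2
  rcases player_cases (t ⟨o.1, j⟩) with h3 | h3
  · rw [h3] at h2; exact absurd h2 one_not_le_zero
  · exact h3

end Layout

namespace Campaign

variable {X : Type*} {C : Player → Type*} (G : Campaign X C)

/-- Feasibility determines the kind of an order from the control of its objective, so only its
presence matters. This lets orders be transported between states with different control. -/
theorem objProb_own {s : G.State} {p : Player → G.Action} (hp : ∀ i, G.Feasible i s (p i))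
    {i : Player} {o : G.Objective} (ho : s o = i) :
    G.objProb s p o i =
      1 - G.α (opp i) o s * ind (p (opp i) o) * (1 - G.ρ i o s * ind (p i o)) := by
  unfold objProb
  rw [if_pos ho]
  rcases (hp i).own ho with h1 | h1 <;>
    rcases (hp (opp i)).opp (ho.trans (opp_opp i).symm) with h2 | h2 <;> simp [h1, h2]

theorem objProb_opp {s : G.State} {p : Player → G.Action} (hp : ∀ i, G.Feasible i s (p i))
    {i : Player} {o : G.Objective} (ho : s o = opp i) :
    G.objProb s p o i =
      G.α i o s * ind (p i o) * (1 - G.ρ (opp i) o s * ind (p (opp i) o)) := by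
  unfold objProb
  rw [if_neg (by rw [ho]; exact opp_ne i)]
  rcases (hp i).opp ho with h1 | h1 <;>
    rcases (hp (opp i)).own ho with h2 | h2 <;> simp [h1, h2]

/-- The probability that `o` is won from `opp i` despite a reinforcement order `y`, weighted by an
attack order `x`, is monotone in the base probabilities. -/
theorem attack_le {α α' ρ ρ' x y : ℝ} (h0 : 0 ≤ α) (hα : α ≤ α') (hρ : ρ' ≤ ρ) (hρ1 : ρ ≤ 1)
    (hx : 0 ≤ x) (hy : 0 ≤ y) (hy1 : y ≤ 1) :
    α * x * (1 - ρ * y) ≤ α' * x * (1 - ρ' * y) := by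
  have h1 : α * x ≤ α' * x := mul_le_mul_of_nonneg_right hα hx
  have h2 : ρ' * y ≤ ρ * y := mul_le_mul_of_nonneg_right hρ hy
  have h3 : ρ * y ≤ 1 := mul_le_one₀ hρ1 hy hy1
  exact mul_le_mul h1 (by linarith) (by linarith) (mul_nonneg (h0.trans hα) hx)

variable {G}

theorem objProb_le_objProb (hmono : G.MonotoneOdds) (hrfc : G.DefenseFavored) [DecidableEq X]
    {s t : G.State} (hst : s ≤ t) {p q : Player → G.Action} (hp : ∀ i, G.Feasible i s (p i))
    (hq : ∀ i, G.Feasible i t (q i)) (hpq : ∀ i o, q i o = .none ↔ p i o = .none)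
    (o : G.Objective) : G.objProb s p o 1 ≤ G.objProb t q o 1 := by
  have hind : ∀ i, ind (q i o) = ind (p i o) := by
    intro i
    unfold ind
    simp only [hpq i o]
  obtain ⟨hα0, hρ0, hα1, hρ1⟩ := hmono s t hst o
  have n0 := ind_nonneg (p 0 o)
  have n1 := ind_nonneg (p 1 o)
  have m0 := ind_le_one (p 0 o)
  have m1 := ind_le_one (p 1 o)
  rcases player_cases (s o) with hs | hs <;> rcases player_cases (t o) with ht | ht
  · rw [G.objProb_opp hp (i := 1) hs, G.objProb_opp hq (i := 1) ht, hind, hind, opp_one]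
    exact attack_le (G.α_mem _ _ _).1 hα1 hρ0 (G.ρ_mem _ _ _).2 n1 n0 m0
  · rw [G.objProb_opp hp (i := 1) hs, G.objProb_own hq (i := 1) ht, hind, hind, opp_one]
    -- When control of `o` differs, `DefenseFavored` compares `s` with `s` flipped at `o`, and
    -- monotone odds lead from there to `t`. This settles the case of two orders at `o`; with fewer,
    -- one side is trivially 0 or 1.
    have hut : Function.update s o 1 ≤ t := by
      intro j
      by_cases hj : j = o
      · subst hj; rw [ht, Function.update_self]
      · rw [Function.update_of_ne hj]; exact hst j
    obtain ⟨hα, -, -, hρ⟩ := hmono _ _ hut o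
    have hd := hrfc 0 o s (Function.update s o 1) hs (Function.update_self ..)
      fun o' ho' => (Function.update_of_ne ho' ..).symm
    rw [opp_zero] at hd
    have h1 := attack_le (x := 1) (y := 1) (G.α_mem 0 o t).1 hα hρ (G.ρ_mem 1 o t).2 zero_le_one
      zero_le_one le_rfl
    have hb := G.α_mem 1 o s
    have hc := G.ρ_mem 0 o s
    have hd' := G.α_mem 0 o t
    have he := G.ρ_mem 1 o t
    by_cases h0 : p 0 o = .none <;> by_cases h1' : p 1 o = .none <;>
      simp only [h0, h1', ind_none, ind_of_ne, ne_eq, not_false_eq_true] <;>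
      nlinarith [hb.1, hb.2, hd'.1, hd'.2, hc.1, hc.2, he.1, he.2]
  · exact absurd (hst o) (by rw [hs, ht]; exact one_not_le_zero)
  · rw [G.objProb_own hp (i := 1) hs, G.objProb_own hq (i := 1) ht, hind, hind, opp_one]
    exact sub_le_sub_left (attack_le (G.α_mem _ _ _).1 hα0 hρ1 (G.ρ_mem _ _ _).2 n0 n1 m1) _

theorem feasible_cons {s : G.State} (a : G.FeasAct 0 s) (b : G.FeasAct 1 s) (i : Player) :
    G.Feasible i s ((![a.1, b.1] : Player → G.Action) i) := by
  rcases player_cases i with rfl | rfl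
  · exact a.2
  · exact b.2

variable [Fintype X] [DecidableEq X]

omit [DecidableEq X] in
theorem stageLoss_mono : Monotone G.stageLoss := by
  intro s t hst
  refine Finset.sum_le_sum fun o _ => ?_
  have h := hst o
  have hl := G.loss_nonneg o
  rcases player_cases (s o) with hs | hs <;> rcases player_cases (t o) with ht | ht
  · simp [hs, ht]
  · simp [hs, ht, hl]
  · rw [hs, ht] at h; exact absurd h one_not_le_zero
  · simp [hs, ht]

omit [DecidableEq X] in
theorem stageLoss_strictMono (hpos : ∀ o, 0 < G.loss o) : StrictMono G.stageLoss := by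
  intro s t hst
  obtain ⟨hle, o, ho⟩ := Pi.lt_def.1 hst
  have hs : s o = 0 := by
    rcases player_cases (s o) with h | h
    · exact h
    · rw [h] at ho
      rcases player_cases (t o) with h' | h' <;> rw [h'] at ho <;> exact absurd ho (by decide)
  have ht : t o = 1 := by
    rcases player_cases (t o) with h | h
    · rw [hs, h] at ho; exact absurd ho (lt_irrefl _)
    · exact h
  refine Finset.sum_lt_sum (fun o' _ => ?_) ⟨o, Finset.mem_univ _, ?_⟩
  · have h := hle o'
    have hl := hpos o'
    rcases player_cases (s o') with hs | hs <;> rcases player_cases (t o') with ht | ht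
    · simp [hs, ht]
    · simp [hs, ht, hl.le]
    · rw [hs, ht] at h; exact absurd h one_not_le_zero
    · simp [hs, ht]
  · simp [hs, ht, hpos o]

/-- Two states in the order are compared by letting the players repeat, at one state, the orders
of the other one. -/
theorem IsSaddle.le_add {V : G.State → ℝ} {x : G.Policy 0} {y : G.Policy 1}
    (h : G.IsSaddle V x y) (hmono : G.MonotoneOdds) (hrfc : G.DefenseFavored) {d : ℝ}
    {W : G.State → ℝ} (hW : Monotone W) (h1 : ∀ t, V t ≤ W t) (h2 : ∀ t, W t ≤ V t + d)
    {s t : G.State} (hst : s ≤ t) :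
    V s ≤ V t + (G.stageLoss s - G.stageLoss t + G.γ * d) := by
  refine matrix_value_le
    (fun a : G.FeasAct 0 t => ⟨_, a.2.retype fun _ ho => ho.anti hst⟩)
    (fun b : G.FeasAct 1 s => ⟨_, b.2.retype fun _ ho => ho.mono hst⟩)
    (h s).2 (h t).1 fun a b => ?_
  let p : Player → G.Action := ![Layout.retype 0 s a.1, b.1]
  let q : Player → G.Action := ![a.1, Layout.retype 1 t b.1]
  change G.stageLoss s + G.γ * prodExp (G.objProb s p) V ≤
    G.stageLoss t + G.γ * prodExp (G.objProb t q) V + _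
  -- Monotonicity of `V` is not available yet: the comparison passes through the monotone `W`, at
  -- the cost of `d`.
  have hE : prodExp (G.objProb s p) V ≤ prodExp (G.objProb t q) V + d := by
    calc prodExp (G.objProb s p) V ≤ prodExp (G.objProb s p) W :=
          Finset.sum_le_sum fun u _ => mul_le_mul_of_nonneg_left (h1 u) (G.transProb_nonneg s p u)
      _ ≤ prodExp (G.objProb t q) W := by
          refine prodExp_mono (G.isProbFamily_objProb _ _) (G.isProbFamily_objProb _ _)
            (fun o => objProb_le_objProb hmono hrfc hst
              (feasible_cons ⟨_, a.2.retype fun _ ho => ho.anti hst⟩ b)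
              (feasible_cons a ⟨_, b.2.retype fun _ ho => ho.mono hst⟩) (fun i o => ?_) o) hW
          rcases player_cases i with rfl | rfl
          · exact Layout.retype_eq_none.symm
          · exact Layout.retype_eq_none
      _ ≤ ∑ u, (∏ o, G.objProb t q o (u o)) * (V u + d) :=
          Finset.sum_le_sum fun u _ => mul_le_mul_of_nonneg_left (h2 u) (G.transProb_nonneg t q u)
      _ = prodExp (G.objProb t q) V + d := by
          simp only [mul_add, Finset.sum_add_distrib, ← Finset.sum_mul]
          rw [sum_prod_of_isProbFamily (G.isProbFamily_objProb t q), one_mul, prodExp]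
  have := mul_le_mul_of_nonneg_left hE G.γ_mem.1.le
  linarith

/-- Let `W` be the least monotone majorant of `V` and `d` the largest gap `W - V`, at a state `m`.
As `W m` is attained by `V` at some state below `m`, `IsSaddle.le_add` yields `d ≤ γ * d`, so the
gap vanishes. -/
theorem IsSaddle.monotone {V : G.State → ℝ} {x : G.Policy 0} {y : G.Policy 1}
    (h : G.IsSaddle V x y) (hmono : G.MonotoneOdds) (hrfc : G.DefenseFavored) : Monotone V := by
  classical
  let W : G.State → ℝ := fun t => (Finset.univ.filter (· ≤ t)).sup' ⟨t, by simp⟩ V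
  have hW : Monotone W := fun s t hst => Finset.sup'_mono _
    (fun u hu => by
      simp only [Finset.mem_filter, Finset.mem_univ, true_and] at hu ⊢
      exact hu.trans hst) _
  have hVW : ∀ t, V t ≤ W t := fun t => Finset.le_sup' V (by simp)
  let s₀ : G.State := fun _ => 0
  have : Nonempty G.State := ⟨s₀⟩
  obtain ⟨m, hm⟩ := Finite.exists_max fun t => W t - V t
  have hd : W m - V m ≤ G.γ * (W m - V m) := by
    obtain ⟨u, hu, hWu⟩ := Finset.exists_mem_eq_sup' (s := Finset.univ.filter (· ≤ m))
      ⟨m, by simp⟩ V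
    simp only [Finset.mem_filter, Finset.mem_univ, true_and] at hu
    have h1 := h.le_add hmono hrfc hW hVW (d := W m - V m)
      (fun t => by linarith [hm t]) hu
    have h2 := stageLoss_mono (G := G) hu
    have h3 : W m = V u := hWu
    linarith
  have hd0 : W m - V m ≤ 0 := by nlinarith [G.γ_mem.2]
  intro s t hst
  have h1 := hW hst
  have h2 := hm t
  have h3 := hVW s
  linarith

theorem IsSaddle.strictMono {V : G.State → ℝ} {x : G.Policy 0} {y : G.Policy 1}
    (h : G.IsSaddle V x y) (hmono : G.MonotoneOdds) (hrfc : G.DefenseFavored)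
    (hpos : ∀ o, 0 < G.loss o) : StrictMono V := by
  intro s t hst
  have h1 := h.le_add hmono hrfc (h.monotone hmono hrfc) (fun _ => le_rfl) (d := 0)
    (fun t => (add_zero _).ge) hst.le
  have h2 := stageLoss_strictMono hpos hst
  linarith

end Campaign

end CampaignGame

/-! ### Axis types and their persistence -/

namespace CampaignGame

open MilOrder

namespace Layout

variable {X : Type*} {C : Player → Type*} {G : Layout X C}

theorem ne_zero_iff {i : Player} : i ≠ 0 ↔ i = 1 := by
  rcases player_cases i with rfl | rfl <;> decide

theorem openLoC_zero_iff {s : G.State} {x : X} {k : Fin (G.len x)} :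
    G.OpenLoC 0 s ⟨x, k⟩ ↔ ∀ j : Fin (G.len x), (j : ℕ) < k → s ⟨x, j⟩ = 0 := Iff.rfl

theorem openLoC_one_iff {s : G.State} {x : X} {k : Fin (G.len x)} :
    G.OpenLoC 1 s ⟨x, k⟩ ↔ ∀ j : Fin (G.len x), (k : ℕ) < j → s ⟨x, j⟩ = 1 := Iff.rfl

theorem axisTyped_of_len_eq_one {x : X} (h : G.len x = 1) (s : G.State) : G.AxisTyped s x := by
  have h0 : ∀ j : Fin (G.len x), j = ⟨0, G.len_pos x⟩ := fun j => Fin.ext (by have := j.2; omega)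
  rcases player_cases (s ⟨x, ⟨0, G.len_pos x⟩⟩) with hs | hs
  · exact Or.inl fun j => by rw [h0 j, hs]
  · exact Or.inr (Or.inl fun j => by rw [h0 j, hs])

/-- The four types are exactly what the four control patterns of two adjacent objectives produce;
equal control merely shifts a pure front by one, or completes the axis. -/
theorem axisTyped_of_core {x : X} {s : G.State} {m : ℕ} (hm : m + 1 < G.len x)
    (h0 : ∀ j : Fin (G.len x), (j : ℕ) < m → s ⟨x, j⟩ = 0)
    (h1 : ∀ j : Fin (G.len x), m + 2 ≤ (j : ℕ) → s ⟨x, j⟩ = 1) : G.AxisTyped s x := by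
  rcases player_cases (s ⟨x, ⟨m, by omega⟩⟩) with ha | ha <;>
    rcases player_cases (s ⟨x, ⟨m + 1, hm⟩⟩) with hb | hb
  · have h0' : ∀ j : Fin (G.len x), (j : ℕ) ≤ m + 1 → s ⟨x, j⟩ = 0 := by
      rintro ⟨j, hj⟩ h
      rcases (show j < m ∨ j = m ∨ j = m + 1 by simp only at h; omega) with h | rfl | rfl
      exacts [h0 _ h, ha, hb]
    by_cases hl : m + 2 = G.len x
    · exact Or.inl fun j => h0' j (by have := j.2; omega)
    · exact Or.inr (Or.inr (Or.inl ⟨m + 1, by omega, fun j => ⟨h0' j, h1 j⟩⟩))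
  · refine Or.inr (Or.inr (Or.inl ⟨m, hm, ?_⟩))
    rintro ⟨j, hj⟩
    refine ⟨fun h => ?_, fun h => ?_⟩
    · rcases (show j < m ∨ j = m by simp only at h; omega) with h | rfl
      exacts [h0 _ h, ha]
    · rcases (show m + 2 ≤ j ∨ j = m + 1 by simp only at h; omega) with h | rfl
      exacts [h1 _ h, hb]
  · refine Or.inr (Or.inr (Or.inr ⟨m, hm, ?_⟩))
    rintro ⟨j, hj⟩
    refine ⟨h0 _, fun h => ?_, fun h => ?_, h1 _⟩
    · simp only at h; subst h; exact ha
    · simp only at h; subst h; exact hb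
  · have h1' : ∀ j : Fin (G.len x), m ≤ (j : ℕ) → s ⟨x, j⟩ = 1 := by
      rintro ⟨j, hj⟩ h
      rcases (show m + 2 ≤ j ∨ j = m ∨ j = m + 1 by simp only at h; omega) with h | rfl | rfl
      exacts [h1 _ h, ha, hb]
    by_cases hl : m = 0
    · exact Or.inr (Or.inl fun j => h1' j (by omega))
    · refine Or.inr (Or.inr (Or.inl ⟨m - 1, by omega, fun j => ⟨fun h => h0 j (by omega),
        fun h => h1' j (by omega)⟩⟩))

/-- Axis types are preserved when control only changes at objectives to which the winner has an
open line of control. -/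
theorem AxisTyped.step {x : X} {s t : G.State} (h : G.AxisTyped s x)
    (h01 : ∀ j : Fin (G.len x), s ⟨x, j⟩ = 0 → t ⟨x, j⟩ = 1 → G.OpenLoC 1 s ⟨x, j⟩)
    (h10 : ∀ j : Fin (G.len x), s ⟨x, j⟩ = 1 → t ⟨x, j⟩ = 0 → G.OpenLoC 0 s ⟨x, j⟩) :
    G.AxisTyped t x := by
  have hlen := G.len_pos x
  by_cases hl : G.len x = 1
  · exact axisTyped_of_len_eq_one hl t
  -- An objective with a friendly one between it and the enemy base is shielded from attack. In each
  -- type this leaves only two adjacent objectives that can change hands.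
  have k0 : ∀ (j l : Fin (G.len x)), (j : ℕ) < l → s ⟨x, j⟩ = 0 → s ⟨x, l⟩ = 0 →
      t ⟨x, j⟩ = 0 := by
    intro j l hjl hj hs
    by_contra ht
    have := openLoC_one_iff.1 (h01 j hj (ne_zero_iff.1 ht)) l hjl
    rw [hs] at this
    exact zero_ne_one this
  have k1 : ∀ (j l : Fin (G.len x)), (l : ℕ) < j → s ⟨x, j⟩ = 1 → s ⟨x, l⟩ = 1 →
      t ⟨x, j⟩ = 1 := by
    intro j l hjl hj hs
    by_contra ht
    have h0 : t ⟨x, j⟩ = 0 := (player_cases _).resolve_right ht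
    have := openLoC_zero_iff.1 (h10 j hj h0) l hjl
    rw [hs] at this
    exact one_ne_zero this
  rcases h with h | h | ⟨m, hm, h⟩ | ⟨m, hm, h⟩
  · refine axisTyped_of_core (m := G.len x - 2) (by omega) (fun j hj => ?_) fun j hj => ?_
    · exact k0 j ⟨G.len x - 1, by omega⟩ (by simp only; omega) (h j) (h _)
    · have := j.2
      omega
  · refine axisTyped_of_core (m := 0) (by omega) (fun j hj => ?_) fun j hj => ?_
    · omega
    · exact k1 j ⟨0, hlen⟩ (by simp only; omega) (h j) (h _)
  · refine axisTyped_of_core hm (fun j hj => ?_) fun j hj => ?_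
    · exact k0 j ⟨m, by omega⟩ hj ((h j).1 hj.le) ((h _).1 le_rfl)
    · exact k1 j ⟨m + 1, hm⟩ (by simp only; omega) ((h j).2 (by omega)) ((h _).2 le_rfl)
  · refine axisTyped_of_core hm (fun j hj => ?_) fun j hj => ?_
    · exact k0 j ⟨m + 1, hm⟩ (by simp only; omega) ((h j).1 hj) ((h _).2.2.1 rfl)
    · exact k1 j ⟨m, by omega⟩ (by simp only; omega) ((h j).2.2.2 hj) ((h _).2.1 rfl)

/-! ### Fronts -/

theorem openLoC_of_mem_front {i : Player} {s : G.State} {o : G.Objective}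
    (h : o ∈ G.front i o.1 s) : G.OpenLoC i s o := by
  obtain ⟨x, k⟩ := o
  have hk := k.2
  rcases player_cases i with rfl | rfl
  · rw [openLoC_zero_iff]
    intro j hj
    have hj' := j.2
    rcases h.2 with ⟨h, hf⟩ | ⟨h, hf⟩ | ⟨m, ⟨hm, h⟩, hf⟩ | ⟨m, ⟨hm, h⟩, hf⟩
    · exact h j
    · simp only at hf; omega
    · simp only at hf; exact (h j).1 (by omega)
    · simp only [if_true] at hf; exact (h j).1 (by omega)
  · rw [openLoC_one_iff]
    intro j hj
    have hj' := j.2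
    rcases h.2 with ⟨h, hf⟩ | ⟨h, hf⟩ | ⟨m, ⟨hm, h⟩, hf⟩ | ⟨m, ⟨hm, h⟩, hf⟩
    · simp only at hf hk; omega
    · exact h j
    · simp only at hf; exact (h j).2 (by omega)
    · simp only [one_ne_zero, if_false] at hf; exact (h j).2.2.2 (by omega)

/-- An open line makes `o` the first enemy objective as seen from the base of Player `i`, and in
every type this one lies on the front. -/
theorem mem_front_of_attackable {i : Player} {s : G.State} {o : G.Objective}
    (ht : G.AxisTyped s o.1) (hl : G.OpenLoC i s o) (ho : s o = opp i) :
    o ∈ G.front i o.1 s := by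
  obtain ⟨x, k⟩ := o
  have hk : (k : ℕ) < G.len x := k.2
  replace ht : G.AxisTyped s x := ht
  refine ⟨rfl, ?_⟩
  rcases player_cases i with rfl | rfl
  · rw [openLoC_zero_iff] at hl
    rw [opp_zero] at ho
    rcases ht with h | h | ⟨m, hm, h⟩ | ⟨m, hm, h⟩
    · exact absurd ((h k).symm.trans ho) zero_ne_one
    · refine Or.inr (Or.inl ⟨h, ?_⟩)
      by_contra h0
      have := hl ⟨0, G.len_pos x⟩ (Nat.pos_of_ne_zero h0)
      exact one_ne_zero ((h _).symm.trans this)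
    · refine Or.inr (Or.inr (Or.inl ⟨m, ⟨hm, h⟩, Or.inr ?_⟩))
      have h1 : m + 1 ≤ (k : ℕ) := by
        by_contra h1
        exact zero_ne_one (((h k).1 (by omega)).symm.trans ho)
      by_contra h2
      have := hl ⟨m + 1, hm⟩ (by simp only at h2 ⊢; omega)
      exact one_ne_zero (((h _).2 le_rfl).symm.trans this)
    · refine Or.inr (Or.inr (Or.inr ⟨m, ⟨hm, h⟩, ?_⟩))
      rw [if_pos rfl]
      by_contra h2
      rcases (show (k : ℕ) < m ∨ (k : ℕ) = m + 1 ∨ m < k by simp only at h2; omega) with h3 | h3 | h3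
      · exact zero_ne_one (((h k).1 h3).symm.trans ho)
      · exact zero_ne_one (((h k).2.2.1 h3).symm.trans ho)
      · have := hl ⟨m, by omega⟩ h3
        exact one_ne_zero (((h _).2.1 rfl).symm.trans this)
  · rw [openLoC_one_iff] at hl
    rw [opp_one] at ho
    rcases ht with h | h | ⟨m, hm, h⟩ | ⟨m, hm, h⟩
    · refine Or.inl ⟨h, ?_⟩
      by_contra h0
      have := hl ⟨(k : ℕ) + 1, by simp only at h0; omega⟩ (by simp)
      exact zero_ne_one ((h _).symm.trans this)
    · exact absurd ((h k).symm.trans ho) one_ne_zero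
    · refine Or.inr (Or.inr (Or.inl ⟨m, ⟨hm, h⟩, Or.inl ?_⟩))
      have h1 : (k : ℕ) ≤ m := by
        by_contra h1
        exact one_ne_zero (((h k).2 (by omega)).symm.trans ho)
      by_contra h2
      have := hl ⟨m, by omega⟩ (by simp only at h2 ⊢; omega)
      exact zero_ne_one (((h _).1 le_rfl).symm.trans this)
    · refine Or.inr (Or.inr (Or.inr ⟨m, ⟨hm, h⟩, ?_⟩))
      rw [if_neg one_ne_zero]
      by_contra h2
      rcases (show m + 2 ≤ (k : ℕ) ∨ (k : ℕ) = m ∨ (k : ℕ) < m + 1 by simp only at h2; omega)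
        with h3 | h3 | h3
      · exact one_ne_zero (((h k).2.2.2 h3).symm.trans ho)
      · exact one_ne_zero (((h k).2.1 h3).symm.trans ho)
      · have := hl ⟨m + 1, hm⟩ h3
        exact zero_ne_one (((h _).2.2.1 rfl).symm.trans this)

/-- Player 1 holds everything before `o` and Player 2 everything after it. This excludes a split
front and pins `o` to the common front otherwise. It is the reason why reinforcing off the front is
useless. -/
theorem mem_front_of_contested {s : G.State} {o : G.Objective} (ht : G.AxisTyped s o.1)
    (h0 : G.OpenLoC 0 s o) (h1 : G.OpenLoC 1 s o) (i : Player) : o ∈ G.front i o.1 s := by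
  obtain ⟨x, k⟩ := o
  have hk : (k : ℕ) < G.len x := k.2
  replace ht : G.AxisTyped s x := ht
  refine ⟨rfl, ?_⟩
  rw [openLoC_zero_iff] at h0
  rw [openLoC_one_iff] at h1
  rcases ht with h | h | ⟨m, hm, h⟩ | ⟨m, hm, h⟩
  · refine Or.inl ⟨h, ?_⟩
    by_contra hn
    have := h1 ⟨(k : ℕ) + 1, by simp only at hn; omega⟩ (by simp)
    exact zero_ne_one ((h _).symm.trans this)
  · refine Or.inr (Or.inl ⟨h, ?_⟩)
    by_contra hn
    have := h0 ⟨0, G.len_pos x⟩ (Nat.pos_of_ne_zero hn)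
    exact one_ne_zero ((h _).symm.trans this)
  · refine Or.inr (Or.inr (Or.inl ⟨m, ⟨hm, h⟩, ?_⟩))
    by_contra hn
    rcases (show (k : ℕ) < m ∨ m + 1 < k by simp only at hn; omega) with h3 | h3
    · exact zero_ne_one (((h ⟨m, by omega⟩).1 le_rfl).symm.trans (h1 _ h3))
    · exact one_ne_zero (((h ⟨m + 1, hm⟩).2 le_rfl).symm.trans (h0 _ h3))
  · exfalso
    rcases (show (k : ℕ) ≤ m ∨ m < k by omega) with h3 | h3
    · exact zero_ne_one (((h ⟨m + 1, hm⟩).2.2.1 rfl).symm.trans (h1 _ (by simp only; omega)))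
    · exact one_ne_zero (((h ⟨m, by omega⟩).2.1 rfl).symm.trans (h0 _ h3))

theorem exists_attackable_mem_front {i : Player} {s : G.State} {x : X} (ht : G.AxisTyped s x)
    (hi : ¬ ∀ j, s ⟨x, j⟩ = i) : ∃ k, (⟨x, k⟩ : G.Objective) ∈ G.front i x s ∧
      s ⟨x, k⟩ = opp i := by
  have hlen := G.len_pos x
  rcases player_cases i with rfl | rfl
  · rcases ht with h | h | ⟨m, hm, h⟩ | ⟨m, hm, h⟩
    · exact absurd h hi
    · exact ⟨⟨0, hlen⟩, ⟨rfl, Or.inr (Or.inl ⟨h, rfl⟩)⟩, h _⟩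
    · exact ⟨⟨m + 1, hm⟩, ⟨rfl, Or.inr (Or.inr (Or.inl ⟨m, ⟨hm, h⟩, Or.inr rfl⟩))⟩,
        (h _).2 le_rfl⟩
    · exact ⟨⟨m, by omega⟩, ⟨rfl, Or.inr (Or.inr (Or.inr ⟨m, ⟨hm, h⟩, rfl⟩))⟩, (h _).2.1 rfl⟩
  · rcases ht with h | h | ⟨m, hm, h⟩ | ⟨m, hm, h⟩
    · exact ⟨⟨G.len x - 1, by omega⟩, ⟨rfl, Or.inl ⟨h, by simp only; omega⟩⟩, h _⟩
    · exact absurd h hi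
    · exact ⟨⟨m, by omega⟩, ⟨rfl, Or.inr (Or.inr (Or.inl ⟨m, ⟨hm, h⟩, Or.inl rfl⟩))⟩,
        (h _).1 le_rfl⟩
    · exact ⟨⟨m + 1, hm⟩, ⟨rfl, Or.inr (Or.inr (Or.inr ⟨m, ⟨hm, h⟩, rfl⟩))⟩, (h _).2.2.1 rfl⟩

theorem exists_mem_front {i : Player} {s : G.State} {x : X} (ht : G.AxisTyped s x) :
    ∃ k, (⟨x, k⟩ : G.Objective) ∈ G.front i x s := by
  have hlen := G.len_pos x
  by_cases hi : ∀ j, s ⟨x, j⟩ = i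
  · rcases player_cases i with rfl | rfl
    · exact ⟨⟨G.len x - 1, by omega⟩, rfl, Or.inl ⟨hi, by simp only; omega⟩⟩
    · exact ⟨⟨0, hlen⟩, rfl, Or.inr (Or.inl ⟨hi, rfl⟩)⟩
  · obtain ⟨k, hk, -⟩ := exists_attackable_mem_front ht hi
    exact ⟨k, hk⟩

end Layout

/-! ### Achievable states -/

namespace Campaign

variable {X : Type*} [Fintype X] [DecidableEq X] {C : Player → Type*} {G : Campaign X C}

omit [Fintype X] [DecidableEq X] in
theorem openLoC_of_objProb_pos {s : G.State} {p : Player → G.Action}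
    (hp : ∀ i, G.Feasible i s (p i)) {i : Player} {o : G.Objective} (hs : s o = opp i)
    (h : G.objProb s p o i ≠ 0) : G.OpenLoC i s o := by
  rw [G.objProb_opp hp hs] at h
  refine (hp i).openLoC fun hn => h ?_
  simp [hn]

omit [DecidableEq X] in
-- A possible transition has no vanishing factor, so every objective that changes hands was attacked
-- along an open line.
theorem mem_typedStates_of_chain_pos {π₁ : G.Policy 0} {π₂ : G.Policy 1} {s t : G.State}
    (hs : s ∈ G.typedStates) (h : G.chain π₁ π₂ s t ≠ 0) : t ∈ G.typedStates := by
  intro x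
  obtain ⟨a, -, ha⟩ := Finset.exists_ne_zero_of_sum_ne_zero h
  obtain ⟨b, -, hb⟩ := Finset.exists_ne_zero_of_sum_ne_zero ha
  have hne : ∀ o, G.objProb s ![a.1, b.1] o (t o) ≠ 0 := fun o =>
    Finset.prod_ne_zero_iff.1 (right_ne_zero_of_mul hb) o (Finset.mem_univ _)
  refine (hs x).step (fun j h0 h1 => ?_) fun j h1 h0 => ?_
  · have := hne ⟨x, j⟩
    rw [h1] at this
    exact openLoC_of_objProb_pos (feasible_cons a b) h0 this
  · have := hne ⟨x, j⟩
    rw [h0] at this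
    exact openLoC_of_objProb_pos (feasible_cons a b) h1 this

theorem mem_typedStates_of_stateLaw_pos {π₁ : G.Policy 0} {π₂ : G.Policy 1} {s₀ : G.State}
    (hs : s₀ ∈ G.typedStates) (n : ℕ) {t : G.State} (h : G.stateLaw π₁ π₂ s₀ n t ≠ 0) :
    t ∈ G.typedStates := by
  induction n generalizing t with
  | zero =>
    have : t = s₀ := by
      by_contra hne
      exact h (if_neg hne)
    rwa [this]
  | succ n ih =>
    obtain ⟨u, -, hu⟩ := Finset.exists_ne_zero_of_sum_ne_zero h
    exact mem_typedStates_of_chain_pos (ih (left_ne_zero_of_mul hu)) (right_ne_zero_of_mul hu)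

theorem achievable_eq (π₁ : G.Policy 0) (π₂ : G.Policy 1) :
    G.achievable π₁ π₂ = G.typedStates := by
  ext s
  constructor
  · rintro ⟨s₀, hs₀, n, hn⟩
    exact mem_typedStates_of_stateLaw_pos hs₀ n hn.ne'
  · exact fun hs => ⟨s, hs, 0, by simp [stateLaw]⟩

end Campaign

end CampaignGame

/-! ### Reallocating orders to the fronts -/

namespace CampaignGame

open MilOrder

namespace Layout

variable {X : Type*} [Finite X] {C : Player → Type*} {G : Layout X C}

theorem Feasible.unique {i : Player} {s : G.State} {a : G.Action} (h : G.Feasible i s a) {c : C i}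
    {o o' : G.Objective} (ho : o.1 ∈ G.resp i c) (ho' : o'.1 ∈ G.resp i c) (hn : a o ≠ .none)
    (hn' : a o' ≠ .none) : o = o' :=
  (Set.ncard_le_one (Set.toFinite _)).1 (h.2 c) _ ⟨ho, atk_or_rfc_iff.2 hn⟩ _
    ⟨ho', atk_or_rfc_iff.2 hn'⟩

/-- An order at the front exhausts the single order that a commander may give, which rules out any
other. -/
theorem Feasible.isFrontAction {i : Player} {s : G.State} {a : G.Action} (h : G.Feasible i s a)
    (hf : ∀ c : C i, ∃ o ∈ G.front i o.1 s, o.1 ∈ G.resp i c ∧ a o ≠ .none) :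
    G.IsFrontAction i s a := by
  refine ⟨?_, fun c => le_antisymm (h.2 c) ?_⟩
  · rintro x o rfl
    refine ⟨fun _ ho => h.opp ho, fun _ ho => h.own ho, fun ho => ?_⟩
    by_contra hn
    obtain ⟨c, hc, -⟩ := G.existsUnique_resp i o.1
    obtain ⟨o', ho', hc', hn'⟩ := hf c
    rw [h.unique hc hc' hn hn'] at ho
    exact ho ho'
  · obtain ⟨o, -, hc, hn⟩ := hf c
    exact (Set.ncard_pos (Set.toFinite _)).2 ⟨o, hc, atk_or_rfc_iff.2 hn⟩

/-- Reallocation of useless orders: every commander `c` without an order at a front in `a` gives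
an order at the front objective `t c` instead. -/
theorem Feasible.exists_front_action {i : Player} {s : G.State} {a : G.Action}
    (h : G.Feasible i s a) (t : C i → G.Objective) (htc : ∀ c, (t c).1 ∈ G.resp i c)
    (htf : ∀ c, t c ∈ G.front i (t c).1 s) :
    ∃ a', G.Feasible i s a' ∧ G.IsFrontAction i s a' ∧
      (∀ o ∈ G.front i o.1 s, a o ≠ .none → a' o ≠ .none) ∧
      ∀ c, (∀ o ∈ G.front i o.1 s, o.1 ∈ G.resp i c → a o = .none) → a' (t c) ≠ .none := by
  classical
  -- The position of the new order of `c`: that of his front order in `a` if there is one, and `t c`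
  -- otherwise.
  have hpos : ∀ c : C i, ∃ o ∈ G.front i o.1 s, o.1 ∈ G.resp i c ∧
      ((∃ o' ∈ G.front i o'.1 s, o'.1 ∈ G.resp i c ∧ a o' ≠ .none) → a o ≠ .none) ∧
      ((∀ o' ∈ G.front i o'.1 s, o'.1 ∈ G.resp i c → a o' = .none) → o = t c) := by
    intro c
    by_cases hc : ∃ o' ∈ G.front i o'.1 s, o'.1 ∈ G.resp i c ∧ a o' ≠ .none
    · obtain ⟨o', h1, h2, h3⟩ := hc
      exact ⟨o', h1, h2, fun _ => h3, fun h4 => absurd (h4 o' h1 h2) h3⟩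
    · exact ⟨t c, htf c, htc c, fun h' => absurd h' hc, fun _ => rfl⟩
  choose pos hpf hpc hpa hpt using hpos
  choose cmd hcmd hcmd' using fun x => G.existsUnique_resp i x
  let a' : G.Action := fun o =>
    if o = pos (cmd o.1) then (if s o = i then .rfc else .atk) else .none
  have ha' : ∀ o, a' o ≠ .none ↔ o = pos (cmd o.1) := by
    intro o
    simp only [a']
    split_ifs with h1 <;> simpa using h1
  have hcp : ∀ c, cmd (pos c).1 = c := fun c => (hcmd' _ c (hpc c)).symm
  have hpn : ∀ c, a' (pos c) ≠ .none := fun c => (ha' _).2 (by rw [hcp])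
  have hfeas : G.Feasible i s a' := by
    refine ⟨fun o => ⟨fun ho => ?_, fun _ ho => ?_, fun _ ho => ?_⟩, fun c => ?_⟩
    · by_contra hn
      have := hpf (cmd o.1)
      rw [← (ha' o).1 hn] at this
      exact ho (openLoC_of_mem_front this)
    · simp only [a', if_pos ho]
      split_ifs <;> simp
    · simp only [a', if_neg (show ¬ s o = i by rw [ho]; exact opp_ne i)]
      split_ifs <;> simp
    · refine (Set.ncard_le_one (Set.toFinite _)).2 ?_
      rintro o ⟨h1, h2⟩ o' ⟨h1', h2'⟩
      rw [(ha' o).1 (atk_or_rfc_iff.1 h2), (ha' o').1 (atk_or_rfc_iff.1 h2'),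
        ← hcmd' _ c h1, ← hcmd' _ c h1']
  refine ⟨a', hfeas, hfeas.isFrontAction fun c => ⟨pos c, hpf c, hpc c, hpn c⟩, ?_, ?_⟩
  · intro o ho hn
    rw [h.unique (hcmd o.1) (hpc (cmd o.1)) hn (hpa _ ⟨o, ho, hcmd _, hn⟩)]
    exact hpn _
  · intro c hc
    rw [← hpt c hc]
    exact hpn c

omit [Finite X] in
theorem exists_front_choice {s : G.State} (hs : s ∈ G.typedStates) (i : Player) :
    ∃ t : C i → G.Objective, ∀ c, (t c).1 ∈ G.resp i c ∧ t c ∈ G.front i (t c).1 s := by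
  have : ∀ c : C i, ∃ o : G.Objective, o.1 ∈ G.resp i c ∧ o ∈ G.front i o.1 s := by
    intro c
    obtain ⟨x, hx⟩ := G.resp_nonempty i c
    obtain ⟨k, hk⟩ := exists_mem_front (i := i) (hs x)
    exact ⟨⟨x, k⟩, hx, hk⟩
  choose t ht using this
  exact ⟨t, ht⟩

omit [Finite X] in
-- The layout matches commanders of Player 1 with those of Player 2; uniqueness of the responsible
-- commander gives the converse.
theorem exists_commander_opp (i : Player) (c : C i) :
    ∃ c' : C (opp i), G.resp (opp i) c' = G.resp i c := by
  rcases player_cases i with rfl | rfl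
  · obtain ⟨c', hc'⟩ := G.symmetric c
    exact ⟨c', hc'.symm⟩
  · obtain ⟨x, hx⟩ := G.resp_nonempty 1 c
    obtain ⟨c', hc', -⟩ := G.existsUnique_resp 0 x
    obtain ⟨d, hd⟩ := G.symmetric c'
    rw [hd] at hc'
    rw [(G.existsUnique_resp 1 x).unique hx hc']
    exact ⟨c', hd⟩

end Layout

open Layout

/-! ### Dominance of front orders -/

namespace Campaign

variable {X : Type*} {C : Player → Type*} {G : Campaign X C}

/-- Orders that do not concern the front are useless, orders at the front do no harm. -/
theorem objProb_le_of_front {s : G.State} (hs : s ∈ G.typedStates) {p q : Player → G.Action}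
    (hp : ∀ j, G.Feasible j s (p j)) (hq : ∀ j, G.Feasible j s (q j)) {i : Player}
    (hopp : q (opp i) = p (opp i))
    (hf : ∀ o ∈ G.front i o.1 s, p i o ≠ .none → q i o ≠ .none) (o : G.Objective) :
    G.objProb s p o i ≤ G.objProb s q o i := by
  have hα := G.α_mem
  have hρ := G.ρ_mem
  have hn := ind_nonneg (p (opp i) o)
  have hn1 := ind_le_one (p (opp i) o)
  rcases eq_or_eq_opp i (s o) with ho | ho
  · rw [G.objProb_own hp ho, G.objProb_own hq ho, hopp]
    by_cases hpi : p i o = .none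
    · rw [hpi, ind_none]
      have h1 : 0 ≤ G.α (opp i) o s * ind (p (opp i) o) := mul_nonneg (hα _ _ _).1 hn
      have h2 : 0 ≤ G.ρ i o s * ind (q i o) := mul_nonneg (hρ _ _ _).1 (ind_nonneg _)
      nlinarith [mul_nonneg h1 h2]
    · by_cases hof : o ∈ G.front i o.1 s
      · rw [ind_of_ne hpi, ind_of_ne (hf o hof hpi)]
      · have h1 := (hp i).openLoC hpi
        -- A reinforced objective off the front cannot be under attack, since it would be open to
        -- both players.
        have h2 : p (opp i) o = .none := by
          by_contra h2
          have h2 := (hp _).openLoC h2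
          rcases player_cases i with rfl | rfl
          · exact hof (mem_front_of_contested (hs o.1) h1 h2 0)
          · exact hof (mem_front_of_contested (hs o.1) h2 h1 1)
        simp [h2]
  · by_cases hpi : p i o = .none
    · rw [G.objProb_opp hp ho, hpi, ind_none, mul_zero, zero_mul]
      exact G.objProb_nonneg _ _ _ _
    · rw [G.objProb_opp hp ho, G.objProb_opp hq ho, hopp, ind_of_ne hpi,
        ind_of_ne (hf o (mem_front_of_attackable (hs o.1) ((hp i).openLoC hpi) ho) hpi)]

/-- The gain is strict whatever the opponent does, because no reinforcement succeeds with certainty;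
a reinforcement gains strictly only against an attack. -/
theorem objProb_lt_of_attack (hnd : G.Nondegenerate) {s : G.State} {p q : Player → G.Action}
    (hp : ∀ j, G.Feasible j s (p j)) (hq : ∀ j, G.Feasible j s (q j)) {i : Player}
    (hopp : q (opp i) = p (opp i)) {o : G.Objective} (ho : s o = opp i) (hpo : p i o = .none)
    (hqo : q i o ≠ .none) : G.objProb s p o i < G.objProb s q o i := by
  rw [G.objProb_opp hp ho, G.objProb_opp hq ho, hopp, hpo, ind_of_ne hqo, ind_none]
  have h1 := hnd.2.1 i s o ((hq i).openLoC hqo) ho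
  have h2 : 0 < 1 - G.ρ (opp i) o s * ind (p (opp i) o) := by
    by_cases hn : p (opp i) o = .none
    · simp [hn]
    · rw [ind_of_ne hn]
      linarith [(hnd.2.2 (opp i) s o ((hp _).openLoC hn) ho).2]
  rw [mul_zero, zero_mul, mul_one]
  exact mul_pos h1 h2

theorem objProb_lt_of_reinforce (hnd : G.Nondegenerate) {s : G.State} {p q : Player → G.Action}
    (hp : ∀ j, G.Feasible j s (p j)) (hq : ∀ j, G.Feasible j s (q j)) {i : Player}
    (hopp : q (opp i) = p (opp i)) {o : G.Objective} (ho : s o = i) (hpo : p i o = .none)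
    (hatk : p (opp i) o ≠ .none) (hqo : q i o ≠ .none) :
    G.objProb s p o i < G.objProb s q o i := by
  rw [G.objProb_own hp ho, G.objProb_own hq ho, hopp, hpo, ind_of_ne hqo, ind_of_ne hatk, ind_none]
  have h1 := hnd.2.1 (opp i) s o ((hp _).openLoC hatk) (by rw [opp_opp, ho])
  have h2 := (hnd.2.2 i s o ((hq i).openLoC hqo) ho).1
  nlinarith [mul_pos h1 h2]

/-- Among the sets `S j` of actions selected at `s`, no action of a player can be replaced by one
that is at least as good at every objective, and better at some objective against some selected
action of the opponent. -/
def Undominated (G : Campaign X C) (s : G.State) (S : Player → Set G.Action) : Prop :=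
  ∀ (i : Player) (p : Player → G.Action), (∀ j, p j ∈ S j) → ∀ a', G.Feasible i s a' →
    (∀ q : Player → G.Action, (∀ j, G.Feasible j s (q j)) → q i = p i →
      ∀ o, G.objProb s q o i ≤ G.objProb s (Function.update q i a') o i) →
    ∀ o, ¬ G.objProb s p o i < G.objProb s (Function.update p i a') o i

theorem feasible_update {s : G.State} {p : Player → G.Action} (hp : ∀ j, G.Feasible j s (p j))
    {i : Player} {a : G.Action} (ha : G.Feasible i s a) (j : Player) :
    G.Feasible j s (Function.update p i a j) := by
  by_cases hj : j = i
  · subst hj; rwa [Function.update_self]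
  · rw [Function.update_of_ne hj]; exact hp j

section Undominated

variable [Finite X] {s : G.State} {S : Player → Set G.Action}

/-- If `c` gives no front order, his order may be placed at any chosen front objective `o` on his
axes. This harms nothing, so undominatedness forbids a strict gain at `o`; the next two results
contradict that. -/
theorem Undominated.exists_not_lt (hU : G.Undominated s S) (hs : s ∈ G.typedStates)
    (hS : ∀ j, ∀ a ∈ S j, G.Feasible j s a) {i : Player} {p : Player → G.Action}
    (hp : ∀ j, p j ∈ S j) {c : C i} (hc : ∀ o ∈ G.front i o.1 s, o.1 ∈ G.resp i c → p i o = .none)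
    {o : G.Objective} (ho : o ∈ G.front i o.1 s) (hoc : o.1 ∈ G.resp i c) :
    ∃ a', G.Feasible i s a' ∧ a' o ≠ .none ∧
      ¬ G.objProb s p o i < G.objProb s (Function.update p i a') o i := by
  classical
  obtain ⟨t, ht⟩ := exists_front_choice hs i
  obtain ⟨a', hfeas, -, hf, hn⟩ := (hS i _ (hp i)).exists_front_action (Function.update t c o)
    (fun d => by
      by_cases hd : d = c
      · subst hd; simpa using hoc
      · rw [Function.update_of_ne hd]; exact (ht d).1)
    (fun d => by
      by_cases hd : d = c
      · subst hd; simpa using ho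
      · rw [Function.update_of_ne hd]; exact (ht d).2)
  have hno := hn c hc
  rw [Function.update_self] at hno
  refine ⟨a', hfeas, hno, hU i p hp a' hfeas (fun q hq hqp => ?_) o⟩
  refine objProb_le_of_front hs hq (feasible_update hq hfeas)
    (Function.update_of_ne (opp_ne i) _ _) fun o ho hqo => ?_
  rw [Function.update_self]
  rw [hqp] at hqo
  exact hf o ho hqo

theorem Undominated.exists_front_order_of_not_own (hU : G.Undominated s S) (hnd : G.Nondegenerate)
    (hs : s ∈ G.typedStates) (hS : ∀ j, ∀ a ∈ S j, G.Feasible j s a) {i : Player}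
    {p : Player → G.Action} (hp : ∀ j, p j ∈ S j) {c : C i} {x : X} (hx : x ∈ G.resp i c)
    (hxi : ¬ ∀ k, s ⟨x, k⟩ = i) :
    ∃ o ∈ G.front i o.1 s, o.1 ∈ G.resp i c ∧ p i o ≠ .none := by
  by_contra! hc
  obtain ⟨k, hk, hks⟩ := exists_attackable_mem_front (hs x) hxi
  obtain ⟨a', hfeas, hn, hlt⟩ := hU.exists_not_lt hs hS hp hc (o := ⟨x, k⟩) hk hx
  exact hlt (objProb_lt_of_attack hnd (fun j => hS j _ (hp j))
    (feasible_update (fun j => hS j _ (hp j)) hfeas) (Function.update_of_ne (opp_ne i) _ _) hks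
    (hc _ hk hx) (by rwa [Function.update_self]))

/-- When `c` already owns all his axes, he has nothing to attack. His counterpart owns none of them,
hence gives a front order by the previous result, and reinforcing the attacked objective is a strict
gain. -/
theorem Undominated.exists_front_order (hU : G.Undominated s S) (hnd : G.Nondegenerate)
    (hs : s ∈ G.typedStates) (hS : ∀ j, ∀ a ∈ S j, G.Feasible j s a) {i : Player}
    {p : Player → G.Action} (hp : ∀ j, p j ∈ S j) (c : C i) :
    ∃ o ∈ G.front i o.1 s, o.1 ∈ G.resp i c ∧ p i o ≠ .none := by
  by_cases hown : ∀ x ∈ G.resp i c, ∀ k, s ⟨x, k⟩ = i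
  · by_contra! hc
    obtain ⟨c', hc'⟩ := exists_commander_opp (G := G.toLayout) i c
    obtain ⟨x, hx⟩ := G.resp_nonempty i c
    obtain ⟨o, hof, hoc, hon⟩ := hU.exists_front_order_of_not_own hnd hs hS hp (c := c')
      (hc'.symm ▸ hx) fun h => opp_ne i ((h ⟨0, G.len_pos x⟩).symm.trans (hown x hx _))
    rw [hc'] at hoc
    have hso : s o = i := hown _ hoc o.2
    -- Owning the whole axis opens the line of Player `i` too, so the attacked objective is
    -- contested and lies on his front.
    have hl : G.OpenLoC i s o := fun j _ => hown _ hoc j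
    have hl' := openLoC_of_mem_front hof
    have hof' : o ∈ G.front i o.1 s := by
      rcases player_cases i with rfl | rfl
      · exact mem_front_of_contested (hs o.1) hl hl' 0
      · exact mem_front_of_contested (hs o.1) hl' hl 1
    obtain ⟨a', hfeas, hn, hlt⟩ := hU.exists_not_lt hs hS hp hc hof' hoc
    exact hlt (objProb_lt_of_reinforce hnd (fun j => hS j _ (hp j))
      (feasible_update (fun j => hS j _ (hp j)) hfeas) (Function.update_of_ne (opp_ne i) _ _) hso
      (hc _ hof' hoc) hon (by rwa [Function.update_self]))
  · push Not at hown
    obtain ⟨x, hx, k, hk⟩ := hown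
    exact hU.exists_front_order_of_not_own hnd hs hS hp hx fun h => hk (h k)

end Undominated

theorem update_cons_zero (a b a' : G.Action) :
    Function.update (![a, b] : Player → G.Action) 0 a' = ![a', b] := by
  funext j
  rcases player_cases j with rfl | rfl
  · simp
  · rw [Function.update_of_ne one_ne_zero]; rfl

theorem update_cons_one (a b b' : G.Action) :
    Function.update (![a, b] : Player → G.Action) 1 b' = ![a, b'] := by
  funext j
  rcases player_cases j with rfl | rfl
  · rw [Function.update_of_ne zero_ne_one]; rfl
  · simp

theorem eq_cons (p : Player → G.Action) : p = ![p 0, p 1] := by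
  funext j
  rcases player_cases j with rfl | rfl <;> rfl

variable [Fintype X] [DecidableEq X]

theorem payoff_le_payoff {V : G.State → ℝ} (hV : Monotone V) {s : G.State} {a a' : G.FeasAct 0 s}
    {b b' : G.FeasAct 1 s}
    (h : ∀ o, G.objProb s ![a.1, b.1] o 1 ≤ G.objProb s ![a'.1, b'.1] o 1) :
    G.payoff V s a b ≤ G.payoff V s a' b' := by
  rw [payoff_eq, payoff_eq]
  have := prodExp_mono (G.isProbFamily_objProb _ _) (G.isProbFamily_objProb _ _) h hV
  linarith [mul_le_mul_of_nonneg_left this G.γ_mem.1.le]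

theorem payoff_lt_payoff {V : G.State → ℝ} (hV : StrictMono V) {s : G.State}
    {a a' : G.FeasAct 0 s} {b b' : G.FeasAct 1 s}
    (h : ∀ o, G.objProb s ![a.1, b.1] o 1 ≤ G.objProb s ![a'.1, b'.1] o 1) (o : G.Objective)
    (ho : G.objProb s ![a.1, b.1] o 1 < G.objProb s ![a'.1, b'.1] o 1) :
    G.payoff V s a b < G.payoff V s a' b' := by
  rw [payoff_eq, payoff_eq]
  have := prodExp_strict_mono (G.isProbFamily_objProb _ _) (G.isProbFamily_objProb _ _) h o ho hV
  linarith [mul_lt_mul_of_pos_left this G.γ_mem.1]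

omit [Fintype X] [DecidableEq X] in
theorem objProb_one (s : G.State) (p : Player → G.Action) (o : G.Objective) :
    G.objProb s p o 1 = 1 - G.objProb s p o 0 := by linarith [G.objProb_add s p o]

/-- Typedness is a premise only of the front property, so that the replacement can be chosen at all
states; the action is kept at the others. -/
theorem exists_front_action_zero {V : G.State → ℝ} (hV : Monotone V) (s : G.State)
    (a : G.FeasAct 0 s) : ∃ a' : G.FeasAct 0 s, (s ∈ G.typedStates → G.IsFrontAction 0 s a'.1) ∧
      ∀ b, G.payoff V s a' b ≤ G.payoff V s a b := by
  by_cases hs : s ∈ G.typedStates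
  · obtain ⟨t, ht⟩ := exists_front_choice hs 0
    obtain ⟨a', hfeas, hfront, hf, -⟩ := a.2.exists_front_action t (fun c => (ht c).1)
      fun c => (ht c).2
    refine ⟨⟨a', hfeas⟩, fun _ => hfront, fun b => payoff_le_payoff hV fun o => ?_⟩
    have := objProb_le_of_front hs (feasible_cons a b) (feasible_cons ⟨a', hfeas⟩ b) (i := 0) rfl
      hf o
    rw [objProb_one, objProb_one]
    linarith
  · exact ⟨a, fun h => absurd h hs, fun b => le_rfl⟩

theorem exists_front_action_one {V : G.State → ℝ} (hV : Monotone V) (s : G.State)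
    (b : G.FeasAct 1 s) : ∃ b' : G.FeasAct 1 s, (s ∈ G.typedStates → G.IsFrontAction 1 s b'.1) ∧
      ∀ a, G.payoff V s a b ≤ G.payoff V s a b' := by
  by_cases hs : s ∈ G.typedStates
  · obtain ⟨t, ht⟩ := exists_front_choice hs 1
    obtain ⟨b', hfeas, hfront, hf, -⟩ := b.2.exists_front_action t (fun c => (ht c).1)
      fun c => (ht c).2
    exact ⟨⟨b', hfeas⟩, fun _ => hfront, fun a => payoff_le_payoff hV fun o =>
      objProb_le_of_front hs (feasible_cons a b) (feasible_cons a ⟨b', hfeas⟩) (i := 1) rfl hf o⟩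
  · exact ⟨b, fun h => absurd h hs, fun b => le_rfl⟩

end Campaign

theorem exists_pushforward {A : Type*} [Fintype A] (F : A → A) (x : stdSimplex ℝ A) :
    ∃ y : stdSimplex ℝ A, (∀ f : A → ℝ, ∑ a, y.1 a * f a = ∑ a, x.1 a * f (F a)) ∧
      ∀ a, 0 < y.1 a → ∃ a₀, F a₀ = a := by
  classical
  have key : ∀ f : A → ℝ, ∑ a, (∑ a₀, if F a₀ = a then x.1 a₀ else 0) * f a =
      ∑ a, x.1 a * f (F a) := by
    intro f
    simp only [Finset.sum_mul]
    rw [Finset.sum_comm]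
    simp
  refine ⟨⟨fun a => ∑ a₀, if F a₀ = a then x.1 a₀ else 0, fun a => Finset.sum_nonneg fun a₀ _ => ?_,
    ?_⟩, key, fun a ha => ?_⟩
  · split_ifs
    exacts [x.2.1 a₀, le_rfl]
  · have := key fun _ => 1
    simpa [x.2.2] using this
  · obtain ⟨a₀, -, h⟩ := Finset.exists_ne_zero_of_sum_ne_zero ha.ne'
    refine ⟨a₀, ?_⟩
    by_contra hne
    exact h (if_neg hne)

/-! ### Equilibria at the fronts -/

namespace Campaign

variable {X : Type*} [Fintype X] [DecidableEq X] {C : Player → Type*} {G : Campaign X C}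

theorem exists_isMPE_playsAtFronts (hmono : G.MonotoneOdds) (hrfc : G.DefenseFavored) :
    ∃ (π₁ : G.Policy 0) (π₂ : G.Policy 1), G.IsMPE π₁ π₂ ∧ G.PlaysAtFronts π₁ π₂ := by
  obtain ⟨V, x, y, h⟩ := G.exists_isSaddle
  have hV := h.monotone hmono hrfc
  choose F hF hFle using exists_front_action_zero hV
  choose F' hF' hFle' using exists_front_action_one hV
  choose x' hx' hxs using fun s => exists_pushforward (F s) (x s)
  choose y' hy' hys using fun s => exists_pushforward (F' s) (y s)
  -- The replacements are no worse against every action of the opponent, so both strategies can be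
  -- pushed forward at once, with the same `V`.
  have hsad : G.IsSaddle V x' y' := by
    intro s
    refine ⟨fun b => ?_, fun a => ?_⟩
    · rw [hx']
      exact (Finset.sum_le_sum fun a _ =>
        mul_le_mul_of_nonneg_left (hFle s a b) ((x s).2.1 a)).trans ((h s).1 b)
    · rw [hy']
      exact ((h s).2 a).trans (Finset.sum_le_sum fun b _ =>
        mul_le_mul_of_nonneg_left (hFle' s b a) ((y s).2.1 b))
  refine ⟨x', y', hsad.isMPE, fun s hs => ?_⟩
  replace hs : s ∈ G.typedStates := (achievable_eq (G := G) x' y').subset hs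
  refine ⟨fun a ha => ?_, fun b hb => ?_⟩
  · obtain ⟨a₀, rfl⟩ := hxs s a ha
    exact hF s a₀ hs
  · obtain ⟨b₀, rfl⟩ := hys s b hb
    exact hF' s b₀ hs

/-- The actions selected with positive probability at `s`. -/
def selected (x : G.Policy 0) (y : G.Policy 1) (s : G.State) : Player → Set G.Action :=
  ![{a | ∃ h : G.Feasible 0 s a, 0 < (x s).1 ⟨a, h⟩},
    {b | ∃ h : G.Feasible 1 s b, 0 < (y s).1 ⟨b, h⟩}]

theorem exists_pos {A : Type*} [Fintype A] (x : stdSimplex ℝ A) : ∃ a, 0 < x.1 a := by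
  obtain ⟨a, -, ha⟩ := Finset.exists_lt_of_sum_lt (s := Finset.univ) (f := fun _ => (0 : ℝ))
    (g := x.1) (by rw [x.2.2]; simp)
  exact ⟨a, ha⟩

/-- Strict monotonicity of `V` turns better odds at all objectives, strict at one against a selected
reply, into a payoff domination that no equilibrium action admits. -/
theorem IsSaddle.undominated {V : G.State → ℝ} {x : G.Policy 0} {y : G.Policy 1}
    (h : G.IsSaddle V x y) (hV : StrictMono V) (s : G.State) :
    G.Undominated s (selected x y s) := by
  intro i p hp a' ha' hle o hlt
  obtain ⟨ha, hxa⟩ := hp 0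
  obtain ⟨hb, hyb⟩ := hp 1
  rw [eq_cons p] at hlt
  rcases player_cases i with rfl | rfl
  · have hle' : ∀ (b : G.FeasAct 1 s) (o : G.Objective),
        G.objProb s ![a', b.1] o 1 ≤ G.objProb s ![p 0, b.1] o 1 := by
      intro b o
      have := hle ![p 0, b.1] (feasible_cons ⟨_, ha⟩ b) rfl o
      rw [update_cons_zero] at this
      rw [objProb_one, objProb_one]
      linarith
    rw [update_cons_zero] at hlt
    refine h.not_dominated_zero (a := ⟨_, ha⟩) (a' := ⟨a', ha'⟩) hxa
      (fun b => payoff_le_payoff hV.monotone (hle' b)) ⟨_, hb⟩ hyb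
      (payoff_lt_payoff hV (hle' _) o ?_)
    rw [objProb_one, objProb_one]
    linarith
  · have hle' : ∀ (a : G.FeasAct 0 s) (o : G.Objective),
        G.objProb s ![a.1, p 1] o 1 ≤ G.objProb s ![a.1, a'] o 1 := by
      intro a o
      have := hle ![a.1, p 1] (feasible_cons a ⟨_, hb⟩) rfl o
      rwa [update_cons_one] at this
    rw [update_cons_one] at hlt
    exact h.not_dominated_one (b := ⟨_, hb⟩) (b' := ⟨a', ha'⟩) hyb
      (fun a => payoff_le_payoff hV.monotone (hle' a)) ⟨_, ha⟩ hxa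
      (payoff_lt_payoff hV (hle' _) o hlt)

theorem IsMPE.playsAtFronts {x : G.Policy 0} {y : G.Policy 1} (h : G.IsMPE x y)
    (hmono : G.MonotoneOdds) (hrfc : G.DefenseFavored) (hnd : G.Nondegenerate) :
    G.PlaysAtFronts x y := by
  intro s hs
  rw [achievable_eq] at hs
  have hU := h.isSaddle.undominated (h.isSaddle.strictMono hmono hrfc hnd.1) s
  have hS : ∀ j, ∀ a ∈ selected x y s j, G.Feasible j s a := by
    intro j a ha
    rcases player_cases j with rfl | rfl
    exacts [ha.1, ha.1]
  have hpair : ∀ (a : G.FeasAct 0 s) (b : G.FeasAct 1 s), 0 < (x s).1 a → 0 < (y s).1 b →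
      ∀ j, (![a.1, b.1] : Player → G.Action) j ∈ selected x y s j := by
    intro a b ha hb j
    rcases player_cases j with rfl | rfl
    exacts [⟨a.2, ha⟩, ⟨b.2, hb⟩]
  refine ⟨fun a ha => a.2.isFrontAction fun c => ?_, fun b hb => b.2.isFrontAction fun c => ?_⟩
  · obtain ⟨b, hb⟩ := exists_pos (y s)
    exact hU.exists_front_order hnd hs hS (hpair a b ha hb) c
  · obtain ⟨a, ha⟩ := exists_pos (x s)
    exact hU.exists_front_order hnd hs hS (hpair a b ha hb) c

end Campaign

end CampaignGame

theorem proposition1 {X : Type*} [Fintype X] [DecidableEq X] {C : CampaignGame.Player → Type*}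
    (G : CampaignGame.Campaign X C) (hmono : G.MonotoneOdds) (hrfc : G.DefenseFavored) :
    (∀ (π₁ : G.Policy 0) (π₂ : G.Policy 1), G.achievable π₁ π₂ = G.typedStates) ∧
    (∃ (π₁ : G.Policy 0) (π₂ : G.Policy 1), G.IsMPE π₁ π₂ ∧ G.PlaysAtFronts π₁ π₂) ∧
    (G.Nondegenerate → ∀ (π₁ : G.Policy 0) (π₂ : G.Policy 1),
      G.IsMPE π₁ π₂ → G.PlaysAtFronts π₁ π₂) :=
  ⟨CampaignGame.Campaign.achievable_eq,
    CampaignGame.Campaign.exists_isMPE_playsAtFronts hmono hrfc,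
    fun hnd _ _ h => h.playsAtFronts hmono hrfc hnd⟩
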